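/- Throughout, $\mathcal X,\mathcal S$ are finite nonempty sets, $\mathcal H_B$ is a finite-dimensional Hilbert space, logarithms are to base $2$, and $\{A\succeq 0\}$ denotes the projection onto the span of the eigenvectors with nonnegative eigenvalue of a Hermitian operator $A$. For a sequence $\{(U^n,S^n)\}_{n\ge1}$ of pairs of finite-valued random variables put $$\overline{\mathbf I}[\mathbf U;\mathbf S]=\inf\Big\{a\in\mathbb R:\ \lim_{n\to\infty}\Pr\Big\{\tfrac1n\log\tfrac{p_{U^nS^n}(U^n,S^n)}{p_{U^n}(U^n)\,p_{S^n}(S^n)}>a+\gamma\Big\}=0\ \text{ for all }\gamma>0\Big\},$$ and for a sequence of bipartite states $\Theta^{U^nB^n}$ with marginals $\Theta^{U^n},\Theta^{B^n}$ put $$\underline{\mathbf I}[\mathbf U;\mathbf B]=\sup\Big\{a\in\mathbb R:\ \lim_{n\to\infty}\mathrm{Tr}\big[\{\Theta^{U^nB^n}-2^{n(a-\gamma)}\,\Theta^{U^n}\otimes\Theta^{B^n}\succeq0\}\,\Theta^{U^nB^n}\big]=1\ \text{ for all }\gamma>0\Big\}.$$ (a) Let $\{\rho^{B^n}_{x^n}\}_{x^n\in\mathcal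 X^n}$, $n\ge1$, be an arbitrary sequence of classical-quantum channels, with $\rho^{B^n}_{x^n}$ a density operator on $\mathcal H_B^{\otimes n}$. An $(n,M_n,\varepsilon_n)$ code consists of a (possibly randomized) encoder $f_n:[1:M_n]\to\mathcal X^n$ and a POVM $\{\beta(m)\}_{m\in[1:M_n]}$ on $\mathcal H_B^{\otimes n}$ with $\frac1{M_n}\sum_m\mathbb E\,\mathrm{Tr}\big[(\mathbb I-\beta(m))\,\rho^{B^n}_{f_n(m)}\big]\le\varepsilon_n$. A rate $R\in\mathbb R$ is achievable if for every $\varepsilon>0$ there is a sequence of $(n,M_n,\varepsilon_n)$ codes with $\liminf_{n}\frac1n\log M_n>R$ and $\limsup_n\varepsilon_n<\varepsilon$; the capacity $C$ is the supremum of the achievable rates. Then $$C=\sup_{\{X^n\}_{n=1}^\infty}\underline{\mathbf I}[\mathbf X;\mathbf B],$$ the supremum being over all sequences of random variables $X^n$ with values in $\mathcal X^n$, and $\underline{\mathbf I}[\mathbf X;\mathbf B]$ being calculated for the states $\sum_{x^n}p_{X^n}(x^n)\,|x^n\rangle\langle x^n|\otimes\rho^{B^n}_{x^n}$. (b) Let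 $\{\rho^{B^n}_{x^n,s^n}\}_{x^n\in\mathcal X^n,\,s^n\in\mathcal S^n}$, $n\ge1$, be an arbitrary sequence of classical-quantum Gel'fand–Pinsker channels, with $\rho^{B^n}_{x^n,s^n}$ a density operator on $\mathcal H_B^{\otimes n}$, whose channel state is a given arbitrary sequence of random variables $S^n\sim p_{S^n}$ on $\mathcal S^n$, and let $s^n$ be known in full (non-causally) at the encoder. That is, an $(n,M_n,\varepsilon_n)$ code consists of a (possibly randomized) encoder $f_n:[1:M_n]\times\mathcal S^n\to\mathcal X^n$ and a POVM $\{\beta(m)\}_{m\in[1:M_n]}$ with $$\frac1{M_n}\sum_m\sum_{s^n}p_{S^n}(s^n)\,\mathbb E\,\mathrm{Tr}\big[(\mathbb I-\beta(m))\,\rho^{B^n}_{f_n(m,s^n),s^n}\big]\le\varepsilon_n,$$ and achievable rates and the capacity $C$ are defined from such codes as in (a). Then $$C=\sup_{\{\Theta_n\}_{n=1}^\infty}\big(\underline{\mathbf I}[\mathbf U;\mathbf B]-\overline{\mathbf I}[\mathbf U;\mathbf S]\big),$$ the supremum being over all sequences of states of the form $$\Theta_n=\sum_{s^n,u^n,x^n}p_{S^n}(s^n)\,p_{U^n\mid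 S^n}(u^n\mid s^n)\,p_{X^n\mid U^nS^n}(x^n\mid u^n,s^n)\,|s^n\rangle\langle s^n|\otimes|u^n\rangle\langle u^n|\otimes|x^n\rangle\langle x^n|\otimes\rho^{B^n}_{x^n,s^n},$$ where $U^n$ takes values in an arbitrary finite set (which may depend on $n$), $p_{U^n\mid S^n}$ and $p_{X^n\mid U^nS^n}$ are arbitrary conditional distributions, and the two quantities are calculated for the reduced states $\Theta^{U^nB^n}=\mathrm{Tr}_{S^nX^n}\Theta_n$ and the joint law of $(U^n,S^n)$. -/

import Mathlib

noncomputable section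

namespace CQ

open Filter Topology
open scoped Kronecker ComplexOrder

/-! ### Operators on finite-dimensional Hilbert spaces -/

/-- Density matrices: positive semidefinite operators of trace one. -/
def IsDensity {d : Type*} [Fintype d] (ρ : Matrix d d ℂ) : Prop :=
  ρ.PosSemidef ∧ ρ.trace = 1

/-- The projection `{A ⪰ 0}` onto the span of the eigenvectors of the Hermitian matrix `A`
with nonnegative eigenvalue, i.e. the functional calculus of the indicator of `[0, ∞)`. -/
def nonnegProj {d : Type*} [Fintype d] [DecidableEq d] (A : Matrix d d ℂ) : Matrix d d ℂ :=
  cfc (Set.indicator (Set.Ici (0 : ℝ)) (fun _ => (1 : ℝ))) A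

/-- Partial trace over the second tensor factor. -/
def traceSnd {d e : Type*} [Fintype e] (τ : Matrix (d × e) (d × e) ℂ) : Matrix d d ℂ :=
  Matrix.of fun i i' => ∑ j, τ (i, j) (i', j)

/-- Partial trace over the first tensor factor. -/
def traceFst {d e : Type*} [Fintype d] (τ : Matrix (d × e) (d × e) ℂ) : Matrix e e ℂ :=
  Matrix.of fun j j' => ∑ i, τ (i, j) (i, j')

/-- The rank one projection `|i⟩⟨i|` on a basis vector. -/
def ketbra {d : Type*} [DecidableEq d] (i : d) : Matrix d d ℂ := Matrix.single i i 1

/-! ### Information-spectrum quantities -/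

/-- The spectral-sup mutual information rate of a sequence of pairs of finite-valued random
variables, given by their joint distributions. -/
def spectralSupMI {α β : ℕ → Type*} [∀ n, Fintype (α n)] [∀ n, Fintype (β n)]
    (p : ∀ n, α n → β n → ℝ) : EReal :=
  sInf ((fun a : ℝ => (a : EReal)) '' {a : ℝ | ∀ γ : ℝ, 0 < γ →
    Tendsto (fun n : ℕ => ∑ u, ∑ s,
      (if a + γ < 1 / (n : ℝ) * Real.logb 2 (p n u s / ((∑ s', p n u s') * (∑ u', p n u' s)))
        then p n u s else 0)) atTop (𝓝 0)})

/-- The spectral-inf rate `I̲[ρ; σ]` of two sequences of operators. -/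
def spectralInf {d : ℕ → Type*} [∀ n, Fintype (d n)] [∀ n, DecidableEq (d n)]
    (ρ σ : ∀ n, Matrix (d n) (d n) ℂ) : EReal :=
  sSup ((fun a : ℝ => (a : EReal)) '' {a : ℝ | ∀ γ : ℝ, 0 < γ →
    Tendsto (fun n : ℕ =>
      (nonnegProj (ρ n - ((2 : ℝ) ^ ((n : ℝ) * (a - γ))) • σ n) * ρ n).trace.re)
      atTop (𝓝 1)})

/-- The spectral-inf mutual information rate of a sequence of bipartite states: the rate
`I̲[τ^{UB}; τ^U ⊗ τ^B]`. -/
def spectralInfMI {d e : ℕ → Type*} [∀ n, Fintype (d n)] [∀ n, DecidableEq (d n)]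
    [∀ n, Fintype (e n)] [∀ n, DecidableEq (e n)]
    (τ : ∀ n, Matrix (d n × e n) (d n × e n) ℂ) : EReal :=
  spectralInf τ (fun n => traceSnd (τ n) ⊗ₖ traceFst (τ n))

/-! ### Classical-quantum channels without state -/

/-- A code with `M` messages for `n` uses of a classical-quantum channel: a (possibly
randomized) encoder, `enc m x` being the probability that message `m` is sent as `x`, and a
decoding POVM. -/
structure CQCode (X B : Type*) [Fintype X] [Fintype B] [DecidableEq B] (n M : ℕ) where
  enc : Fin M → (Fin n → X) → ℝ
  enc_mem : ∀ m, enc m ∈ stdSimplex ℝ (Fin n → X)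
  dec : Fin M → Matrix (Fin n → B) (Fin n → B) ℂ
  dec_pos : ∀ m, (dec m).PosSemidef
  dec_sum : ∑ m, dec m = 1

/-- Average probability of error of a code over the channel `x ↦ ρ x`. -/
def CQCode.error {X B : Type*} [Fintype X] [Fintype B] [DecidableEq B] {n M : ℕ}
    (c : CQCode X B n M) (ρ : (Fin n → X) → Matrix (Fin n → B) (Fin n → B) ℂ) : ℝ :=
  1 / (M : ℝ) * ∑ m, ∑ x, c.enc m x * ((1 - c.dec m) * ρ x).trace.re

/-- The rate `R` is achievable: for every `ε > 0` there is a sequence of `(n, Mₙ, εₙ)` codes with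
`liminf (1/n) log Mₙ > R` and `limsup εₙ < ε`. -/
def CQAchievable {X B : Type*} [Fintype X] [Fintype B] [DecidableEq B]
    (ρ : ∀ n, (Fin n → X) → Matrix (Fin n → B) (Fin n → B) ℂ) (R : ℝ) : Prop :=
  ∀ ε : ℝ, 0 < ε → ∃ (M : ℕ → ℕ) (e : ℕ → ℝ) (c : ∀ n, CQCode X B n (M n)),
    (∀ n, 0 < M n) ∧ (∀ n, (c n).error (ρ n) ≤ e n) ∧
    (R : EReal) < liminf (fun n : ℕ => ((1 / (n : ℝ) * Real.logb 2 (M n) : ℝ) : EReal)) atTop ∧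
    limsup (fun n : ℕ => (e n : EReal)) atTop < (ε : EReal)

/-- The capacity: the supremum of the achievable rates. -/
def cqCapacity {X B : Type*} [Fintype X] [Fintype B] [DecidableEq B]
    (ρ : ∀ n, (Fin n → X) → Matrix (Fin n → B) (Fin n → B) ℂ) : EReal :=
  sSup ((fun R : ℝ => (R : EReal)) '' {R : ℝ | CQAchievable ρ R})

/-- The state `∑ₓ p(x) |x⟩⟨x| ⊗ ρₓ`. -/
def cqState {A B : Type*} [Fintype A] [DecidableEq A] (p : A → ℝ) (ρ : A → Matrix B B ℂ) :
    Matrix (A × B) (A × B) ℂ :=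
  ∑ x, p x • (ketbra x ⊗ₖ ρ x)

/-! ### Gel'fand–Pinsker channels with the state available at the encoder -/

/-- A code with `M` messages for `n` uses of a classical-quantum Gel'fand–Pinsker channel whose
whole state sequence is known to the encoder: a (possibly randomized) encoder, `enc m s x` being
the probability that message `m` is sent as `x` when the state sequence is `s`, and a decoding
POVM. -/
structure GPCode (X S B : Type*) [Fintype X] [Fintype B] [DecidableEq B] (n M : ℕ) where
  enc : Fin M → (Fin n → S) → (Fin n → X) → ℝ
  enc_mem : ∀ m s, enc m s ∈ stdSimplex ℝ (Fin n → X)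
  dec : Fin M → Matrix (Fin n → B) (Fin n → B) ℂ
  dec_pos : ∀ m, (dec m).PosSemidef
  dec_sum : ∑ m, dec m = 1

/-- Probability of error of a code, averaged over the messages and the state sequence. -/
def GPCode.error {X S B : Type*} [Fintype X] [Fintype S] [Fintype B] [DecidableEq B] {n M : ℕ}
    (c : GPCode X S B n M)
    (ρ : (Fin n → X) → (Fin n → S) → Matrix (Fin n → B) (Fin n → B) ℂ)
    (pS : (Fin n → S) → ℝ) : ℝ :=
  1 / (M : ℝ) * ∑ m, ∑ s, pS s * ∑ x, c.enc m s x * ((1 - c.dec m) * ρ x s).trace.re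

/-- The rate `R` is achievable: for every `ε > 0` there is a sequence of `(n, Mₙ, εₙ)` codes with
`liminf (1/n) log Mₙ > R` and `limsup εₙ < ε`. -/
def GPAchievable {X S B : Type*} [Fintype X] [Fintype S] [Fintype B] [DecidableEq B]
    (ρ : ∀ n, (Fin n → X) → (Fin n → S) → Matrix (Fin n → B) (Fin n → B) ℂ)
    (pS : ∀ n, (Fin n → S) → ℝ) (R : ℝ) : Prop :=
  ∀ ε : ℝ, 0 < ε → ∃ (M : ℕ → ℕ) (e : ℕ → ℝ) (c : ∀ n, GPCode X S B n (M n)),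
    (∀ n, 0 < M n) ∧ (∀ n, (c n).error (ρ n) (pS n) ≤ e n) ∧
    (R : EReal) < liminf (fun n : ℕ => ((1 / (n : ℝ) * Real.logb 2 (M n) : ℝ) : EReal)) atTop ∧
    limsup (fun n : ℕ => (e n : EReal)) atTop < (ε : EReal)

/-- The capacity: the supremum of the achievable rates. -/
def gpCapacity {X S B : Type*} [Fintype X] [Fintype S] [Fintype B] [DecidableEq B]
    (ρ : ∀ n, (Fin n → X) → (Fin n → S) → Matrix (Fin n → B) (Fin n → B) ℂ)
    (pS : ∀ n, (Fin n → S) → ℝ) : EReal :=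
  sSup ((fun R : ℝ => (R : EReal)) '' {R : ℝ | GPAchievable ρ pS R})

/-- The free part of a state `Θₙ`: a finite alphabet `{1, …, k}` for `Uⁿ`, and the conditional
distributions `pU s u = p(u | s)` and `pX u s x = p(x | u, s)`. -/
structure AuxInput (X S : Type*) [Fintype X] (n : ℕ) where
  k : ℕ
  pU : (Fin n → S) → Fin k → ℝ
  pU_mem : ∀ s, pU s ∈ stdSimplex ℝ (Fin k)
  pX : Fin k → (Fin n → S) → (Fin n → X) → ℝ
  pX_mem : ∀ u s, pX u s ∈ stdSimplex ℝ (Fin n → X)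

/-- The state
`Θₙ = ∑ p(s) p(u | s) p(x | u, s) |s⟩⟨s| ⊗ |u⟩⟨u| ⊗ |x⟩⟨x| ⊗ ρ_{x,s}`. -/
def AuxInput.theta {X S B : Type*} [Fintype X] [Fintype S] [DecidableEq X] [DecidableEq S]
    {n : ℕ} (a : AuxInput X S n)
    (ρ : (Fin n → X) → (Fin n → S) → Matrix (Fin n → B) (Fin n → B) ℂ)
    (pS : (Fin n → S) → ℝ) :
    Matrix ((Fin n → S) × Fin a.k × (Fin n → X) × (Fin n → B))
      ((Fin n → S) × Fin a.k × (Fin n → X) × (Fin n → B)) ℂ :=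
  ∑ s, ∑ u, ∑ x, (pS s * a.pU s u * a.pX u s x) •
    (ketbra s ⊗ₖ (ketbra u ⊗ₖ (ketbra x ⊗ₖ ρ x s)))

/-- The reduced state `Tr_{Sⁿ Xⁿ} Θ` on `Uⁿ Bⁿ`. -/
def reduceUB {S U X B : Type*} [Fintype S] [Fintype X]
    (Θ : Matrix (S × U × X × B) (S × U × X × B) ℂ) : Matrix (U × B) (U × B) ℂ :=
  Matrix.of fun i j => ∑ s, ∑ x, Θ (s, i.1, x, i.2) (s, j.1, x, j.2)

/-- The joint distribution of `(Uⁿ, Sⁿ)`. -/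
def AuxInput.jointUS {X S : Type*} [Fintype X] {n : ℕ} (a : AuxInput X S n)
    (pS : (Fin n → S) → ℝ) : Fin a.k → (Fin n → S) → ℝ :=
  fun u s => pS s * a.pU s u

end CQ

end

/-!
Both capacities come down to one-shot statements about the likelihood-ratio test
`{τ^{UB} - c τ^U ⊗ τ^B ⪰ 0}`, which accepts the product of the marginals with weight at
most `1 / c`.

*Achievability.* Draw codewords independently from the input distribution and decode with the
square-root measurement of the tests they induce; the Hayashi–Nagaoka inequality bounds the mean
error by the rejection probability of the test plus the number of codewords over `c`. For a
Gel'fand–Pinsker channel every message owns a bin of codewords, and the encoder picks from the bin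
with probability proportional to the likelihood ratio `q(u,s) / (q(u) q(s))`. Once the bin is larger
than the typical likelihood ratio, the sum of the ratios over the bin concentrates for most `s`, and
a message then behaves as if a uniform codeword of its bin had been sent through the channel
averaged over `s`. The rate left for the messages is the difference of the two spectral rates.

*Converse.* The decoder of a code is itself a test, which accepts the joint state with the
probability of correct decoding but the product of its marginals with probability at most `1 / M`;
the likelihood-ratio test at `c` does at least as well up to `c / M`. In the Gel'fand–Pinsker case
`u` is taken to be the message, which is independent of `s`, so that the subtracted rate is
nonpositive.
-/

namespace CQ

open Filter Topology
open scoped Kronecker ComplexOrder MatrixOrder Matrix.Norms.L2Operator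

/-! ### Square-root measurements -/

section SquareRootMeasurement

variable {A : Type*} [CStarAlgebra A] [PartialOrder A] [StarOrderedRing A]

theorem le_sqrt_add {S T : A} (hS : S ∈ Set.Icc 0 1) (hT : 0 ≤ T) : S ≤ CFC.sqrt (S + T) := by
  have hSS : S * S ≤ S := by
    simpa [pow_two] using CStarAlgebra.pow_antitone hS.1 hS.2 one_le_two
  have h := CFC.sqrt_le_sqrt (S * S) (S + T) (hSS.trans (le_add_of_nonneg_right hT))
  rwa [CFC.sqrt_mul_self S hS.1] at h

theorem rpow_neg_one_half_mul_self {G : A} (hG : IsStrictlyPositive G) :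
    G ^ (-(1 / 2) : ℝ) * G = CFC.sqrt G := by
  nth_rw 2 [← CFC.rpow_one G hG.nonneg]
  rw [← CFC.rpow_add hG.isUnit, CFC.sqrt_eq_rpow]
  norm_num

theorem self_mul_rpow_neg_one_half {G : A} (hG : IsStrictlyPositive G) :
    G * G ^ (-(1 / 2) : ℝ) = CFC.sqrt G := by
  nth_rw 1 [← CFC.rpow_one G hG.nonneg]
  rw [← CFC.rpow_add hG.isUnit, CFC.sqrt_eq_rpow]
  norm_num

theorem hayashi_nagaoka {S T : A} (hS : S ∈ Set.Icc 0 1) (hT : 0 ≤ T)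
    (hST : IsStrictlyPositive (S + T)) :
    1 - (S + T) ^ (-(1 / 2) : ℝ) * S * (S + T) ^ (-(1 / 2) : ℝ)
      ≤ (2 : ℝ) • (1 - S) + (4 : ℝ) • T := by
  set L := (S + T) ^ (-(1 / 2) : ℝ) with hL
  set R := CFC.sqrt (S + T)
  have hLsa : IsSelfAdjoint L := CFC.rpow_nonneg.isSelfAdjoint
  have hLGL : L * T * L = 1 - L * S * L := by
    rw [← CFC.conjugate_rpow_neg_one_half (S + T), ← hL]; noncomm_ring
  have hLG : L * T = R - L * S := by
    rw [eq_sub_iff_add_eq', ← mul_add]; exact rpow_neg_one_half_mul_self hST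
  have hGL : T * L = R - S * L := by
    rw [eq_sub_iff_add_eq', ← add_mul]; exact self_mul_rpow_neg_one_half hST
  have hsos : (2 : ℝ) • (1 - S) + (4 : ℝ) • T - (1 - L * S * L)
      = (L - (1 + 1)) * T * (L - (1 + 1)) + (2 : ℝ) • ((L - 1) * S * (L - 1))
        + (4 : ℝ) • (R - S) := by
    have hT2 : (L - (1 + 1)) * T * (L - (1 + 1))
        = L * T * L - (2 : ℝ) • (L * T) - (2 : ℝ) • (T * L) + (4 : ℝ) • T := by
      simp only [two_smul, show (4 : ℝ) = 2 + 2 by norm_num, add_smul]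
      noncomm_ring
    have hS1 : (L - 1) * S * (L - 1) = L * S * L - L * S - S * L + S := by noncomm_ring
    rw [hT2, hS1, hLGL, hLG, hGL]
    module
  have h1 := (hLsa.sub ((IsSelfAdjoint.one A).add (.one A))).conjugate_nonneg hT
  have h2 := (hLsa.sub (.one A)).conjugate_nonneg hS.1
  have h3 := sub_nonneg.mpr (le_sqrt_add hS hT)
  rw [← sub_nonneg, hsos]
  exact add_nonneg (add_nonneg h1 (smul_nonneg (by norm_num) h2)) (smul_nonneg (by norm_num) h3)

variable {I : Type*} [Fintype I]

/-- The square-root measurement `G^(-1/2) (P i) G^(-1/2)` of a family of effects `P`. The sum `G`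
of the effects is regularised by `δ • 1` so that it is invertible. -/
noncomputable def squareRootMeas (P : I → A) (δ : ℝ) (i : I) : A :=
  (∑ j, P j + δ • 1) ^ (-(1 / 2) : ℝ) * P i * (∑ j, P j + δ • 1) ^ (-(1 / 2) : ℝ)

variable {P : I → A} {δ : ℝ}

theorem squareRootMeas_nonneg (hP : ∀ i, 0 ≤ P i) (i : I) : 0 ≤ squareRootMeas P δ i :=
  CFC.rpow_nonneg.isSelfAdjoint.conjugate_nonneg (hP i)

theorem isStrictlyPositive_sum_add_smul_one (hP : ∀ i, 0 ≤ P i) (hδ : 0 < δ) :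
    IsStrictlyPositive (∑ j, P j + δ • (1 : A)) :=
  .nonneg_add (Finset.sum_nonneg fun i _ => hP i) (.smul hδ isStrictlyPositive_one)

theorem sum_squareRootMeas_le_one (hP : ∀ i, 0 ≤ P i) (hδ : 0 < δ) :
    ∑ i, squareRootMeas P δ i ≤ 1 := by
  have hG := isStrictlyPositive_sum_add_smul_one hP hδ
  simp only [squareRootMeas, ← Finset.sum_mul, ← Finset.mul_sum]
  have hle : ∑ i, P i ≤ ∑ i, P i + δ • (1 : A) :=
    le_add_of_nonneg_right (smul_nonneg hδ.le zero_le_one)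
  exact (IsSelfAdjoint.conjugate_le_conjugate hle (.of_nonneg CFC.rpow_nonneg)).trans_eq
    (CFC.conjugate_rpow_neg_one_half _ hG)

theorem one_sub_squareRootMeas_le [DecidableEq I] (hP : ∀ i, P i ∈ Set.Icc 0 1) (hδ : 0 < δ)
    (i : I) :
    1 - squareRootMeas P δ i
      ≤ (2 : ℝ) • (1 - P i) + (4 : ℝ) • (∑ j ∈ Finset.univ.erase i, P j + δ • 1) := by
  have hG := isStrictlyPositive_sum_add_smul_one (fun j => (hP j).1) hδ
  rw [squareRootMeas]
  rw [← Finset.add_sum_erase _ _ (Finset.mem_univ i), add_assoc] at hG ⊢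
  exact hayashi_nagaoka (hP i) (add_nonneg (Finset.sum_nonneg fun j _ => (hP j).1)
    (smul_nonneg hδ.le zero_le_one)) hG

theorem exists_le_and_sum_eq_one [Nonempty I] {T : I → A} (hT : ∑ i, T i ≤ 1) :
    ∃ β : I → A, (∀ i, T i ≤ β i) ∧ ∑ i, β i = 1 := by
  classical
  obtain ⟨i₀⟩ := ‹Nonempty I›
  refine ⟨T + Pi.single i₀ (1 - ∑ i, T i), fun i => le_add_of_nonneg_right ?_, ?_⟩
  · rw [Pi.single_apply]
    split_ifs
    exacts [sub_nonneg.mpr hT, le_rfl]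
  · simp [Finset.sum_add_distrib]

end SquareRootMeasurement

/-! ### Traces and tests -/

section Trace

variable {d : Type*} [Fintype d]

theorem re_trace_sum_mul {ι : Type*} (s : Finset ι) (T : ι → Matrix d d ℂ) (ρ : Matrix d d ℂ) :
    ((∑ i ∈ s, T i) * ρ).trace.re = ∑ i ∈ s, (T i * ρ).trace.re := by
  rw [Matrix.sum_mul, Matrix.trace_sum, Complex.re_sum]

theorem re_trace_mul_sum {ι : Type*} (s : Finset ι) (T : Matrix d d ℂ) (ρ : ι → Matrix d d ℂ) :
    (T * ∑ i ∈ s, ρ i).trace.re = ∑ i ∈ s, (T * ρ i).trace.re := by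
  rw [Matrix.mul_sum, Matrix.trace_sum, Complex.re_sum]

theorem re_trace_smul_mul (c : ℝ) (T ρ : Matrix d d ℂ) :
    ((c • T) * ρ).trace.re = c * (T * ρ).trace.re := by
  rw [Matrix.smul_mul, Matrix.trace_smul, Complex.smul_re, smul_eq_mul]

theorem re_trace_mul_smul (c : ℝ) (T ρ : Matrix d d ℂ) :
    (T * (c • ρ)).trace.re = c * (T * ρ).trace.re := by
  rw [Matrix.mul_smul, Matrix.trace_smul, Complex.smul_re, smul_eq_mul]

theorem re_trace_mul_sub_smul (c : ℝ) (T τ σ : Matrix d d ℂ) :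
    (T * (τ - c • σ)).trace.re = (T * τ).trace.re - c * (T * σ).trace.re := by
  rw [Matrix.mul_sub, Matrix.trace_sub, Complex.sub_re, re_trace_mul_smul]

theorem re_trace_one_sub_mul [DecidableEq d] (T ρ : Matrix d d ℂ) :
    ((1 - T) * ρ).trace.re = ρ.trace.re - (T * ρ).trace.re := by
  rw [Matrix.sub_mul, Matrix.one_mul, Matrix.trace_sub, Complex.sub_re]

theorem re_trace_nonneg {ρ : Matrix d d ℂ} (hρ : 0 ≤ ρ) : 0 ≤ ρ.trace.re :=
  (Complex.le_def.mp (Matrix.nonneg_iff_posSemidef.mp hρ).trace_nonneg).1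

theorem coe_re_trace {ρ : Matrix d d ℂ} (hρ : 0 ≤ ρ) : ((ρ.trace.re : ℝ) : ℂ) = ρ.trace :=
  Complex.ext rfl (Complex.le_def.mp (Matrix.nonneg_iff_posSemidef.mp hρ).trace_nonneg).2

theorem re_trace_mul_nonneg {T ρ : Matrix d d ℂ} (hT : 0 ≤ T) (hρ : 0 ≤ ρ) :
    0 ≤ (T * ρ).trace.re := by
  classical
  obtain ⟨a, rfl⟩ := CStarAlgebra.nonneg_iff_eq_star_mul_self.mp hT
  rw [Matrix.mul_assoc, Matrix.trace_mul_comm]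
  exact re_trace_nonneg (star_right_conjugate_nonneg hρ a)

theorem re_trace_mul_le_re_trace_mul {T T' ρ : Matrix d d ℂ} (h : T ≤ T') (hρ : 0 ≤ ρ) :
    (T * ρ).trace.re ≤ (T' * ρ).trace.re := by
  have := re_trace_mul_nonneg (sub_nonneg.mpr h) hρ
  rwa [Matrix.sub_mul, Matrix.trace_sub, Complex.sub_re, sub_nonneg] at this

theorem re_trace_mul_le_re_trace [DecidableEq d] {T ρ : Matrix d d ℂ} (hT : T ≤ 1) (hρ : 0 ≤ ρ) :
    (T * ρ).trace.re ≤ ρ.trace.re := by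
  simpa only [Matrix.one_mul] using re_trace_mul_le_re_trace_mul hT hρ

variable [DecidableEq d]

theorem nonnegProj_mem_Icc (A : Matrix d d ℂ) : nonnegProj A ∈ Set.Icc 0 1 :=
  ⟨cfc_nonneg fun x _ => Set.indicator_nonneg (fun _ _ => zero_le_one) x,
    cfc_le_one _ _ fun x _ => Set.indicator_le' (fun _ _ => le_rfl) (fun _ _ => zero_le_one) x⟩

theorem nonnegProj_mul_self {A : Matrix d d ℂ} (hA : IsSelfAdjoint A) : nonnegProj A * A = A⁺ := by
  have hcont (f : ℝ → ℝ) : ContinuousOn f (spectrum ℝ A) := A.finite_real_spectrum.continuousOn f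
  nth_rw 2 [← cfc_id' ℝ A]
  rw [nonnegProj, ← cfc_mul _ _ A (hcont _) (hcont _), CFC.posPart_def, cfcₙ_eq_cfc]
  refine cfc_congr fun x _ => ?_
  by_cases hx : 0 ≤ x
  · simp [hx]
  · simp [hx, le_of_not_ge hx]

theorem re_trace_mul_le_nonnegProj {A T : Matrix d d ℂ} (hA : IsSelfAdjoint A)
    (hT : T ∈ Set.Icc 0 1) : (T * A).trace.re ≤ (nonnegProj A * A).trace.re := by
  have h := re_trace_mul_nonneg hT.1 (sub_nonneg.mpr (CFC.le_posPart hA))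
  rw [Matrix.mul_sub, Matrix.trace_sub, Complex.sub_re, sub_nonneg] at h
  rw [nonnegProj_mul_self hA]
  exact h.trans (re_trace_mul_le_re_trace hT.2 (CFC.posPart_nonneg A))

theorem re_trace_nonnegProj_sub_smul_mul_le_inv {τ σ : Matrix d d ℂ} (hτ : 0 ≤ τ)
    (hτ1 : τ.trace.re ≤ 1) (hσ : IsSelfAdjoint σ) {c : ℝ} (hc : 0 < c) :
    (nonnegProj (τ - c • σ) * σ).trace.re ≤ c⁻¹ := by
  have hA : IsSelfAdjoint (τ - c • σ) := hτ.isSelfAdjoint.sub ((IsSelfAdjoint.all c).smul hσ)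
  have h := re_trace_nonneg (CFC.posPart_nonneg (τ - c • σ))
  rw [← nonnegProj_mul_self hA, re_trace_mul_sub_smul] at h
  have h1 := (re_trace_mul_le_re_trace (nonnegProj_mem_Icc (τ - c • σ)).2 hτ).trans hτ1
  rw [← one_div, le_div_iff₀' hc]
  linarith

theorem le_re_trace_nonnegProj_sub_smul_mul {τ σ T : Matrix d d ℂ} (hτ : IsSelfAdjoint τ)
    (hσ : 0 ≤ σ) (hT : T ∈ Set.Icc 0 1) {c : ℝ} (hc : 0 ≤ c) :
    (T * τ).trace.re - c * (T * σ).trace.re ≤ (nonnegProj (τ - c • σ) * τ).trace.re := by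
  have h := re_trace_mul_le_nonnegProj
    (hτ.sub ((IsSelfAdjoint.all c).smul hσ.isSelfAdjoint)) hT
  rw [re_trace_mul_sub_smul, re_trace_mul_sub_smul] at h
  have := mul_nonneg hc (re_trace_mul_nonneg (nonnegProj_mem_Icc (τ - c • σ)).1 hσ)
  linarith

end Trace

/-! ### Classical-quantum states -/

section Ensemble

/-- A finite ensemble of states: `ω u` is the state of index `u`, scaled by its probability. -/
structure IsEnsemble {U d : Type*} [Fintype U] [Fintype d] (ω : U → Matrix d d ℂ) : Prop where
  nonneg : ∀ u, 0 ≤ ω u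
  sum_trace : ∑ u, (ω u).trace.re = 1

theorem IsEnsemble.sum_nonneg {U d : Type*} [Fintype U] [Fintype d] {ω : U → Matrix d d ℂ}
    (hω : IsEnsemble ω) : 0 ≤ ∑ u, ω u :=
  Finset.sum_nonneg fun u _ => hω.nonneg u

theorem isEnsemble_smul {U d : Type*} [Fintype U] [Fintype d] {p : U → ℝ}
    {ρ : U → Matrix d d ℂ} (hp : p ∈ stdSimplex ℝ U) (hρ : ∀ u, 0 ≤ ρ u)
    (htr : ∀ u, (p u • ρ u).trace.re = p u) : IsEnsemble (fun u => p u • ρ u) :=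
  ⟨fun u => smul_nonneg (hp.1 u) (hρ u), by simp only [htr, hp.2]⟩

/-- The block diagonal operator `∑ᵤ |u⟩⟨u| ⊗ ω u`; for an ensemble `ω` it is the associated
classical-quantum state. -/
def cqBlock {U d : Type*} [Fintype U] [DecidableEq U] (ω : U → Matrix d d ℂ) :
    Matrix (U × d) (U × d) ℂ :=
  ∑ u, ketbra u ⊗ₖ ω u

/-- The compression `⟨u| T |u⟩` of a bipartite operator to a basis vector of the first factor. -/
def diagBlock {U d : Type*} (T : Matrix (U × d) (U × d) ℂ) (u : U) : Matrix d d ℂ :=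
  T.submatrix (Prod.mk u) (Prod.mk u)

/-- The probability that the test `{τ - c τ^U ⊗ τ^B ⪰ 0}` accepts `τ`, whose asymptotics define
`spectralInfMI`. -/
noncomputable def miAccept {U d : Type*} [Fintype U] [DecidableEq U] [Fintype d] [DecidableEq d]
    (τ : Matrix (U × d) (U × d) ℂ) (c : ℝ) : ℝ :=
  (nonnegProj (τ - c • (traceSnd τ ⊗ₖ traceFst τ)) * τ).trace.re

theorem diagBlock_nonneg {U d : Type*} {T : Matrix (U × d) (U × d) ℂ} (hT : 0 ≤ T) (u : U) :
    0 ≤ diagBlock T u :=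
  ((Matrix.nonneg_iff_posSemidef.mp hT).submatrix _).nonneg

theorem diagBlock_one {U d : Type*} [DecidableEq U] [DecidableEq d] (u : U) :
    diagBlock (1 : Matrix (U × d) (U × d) ℂ) u = 1 := by
  ext i j
  simp [diagBlock, Matrix.one_apply]

theorem diagBlock_mem_Icc {U d : Type*} [DecidableEq U] [DecidableEq d]
    {T : Matrix (U × d) (U × d) ℂ} (hT : T ∈ Set.Icc 0 1) (u : U) :
    diagBlock T u ∈ Set.Icc 0 1 := by
  refine ⟨diagBlock_nonneg hT.1 u, ?_⟩
  rw [← sub_nonneg, ← diagBlock_one u]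
  exact diagBlock_nonneg (sub_nonneg.mpr hT.2) u

variable {U : Type*} [Fintype U] [DecidableEq U]

theorem cqBlock_apply {d : Type*} (ω : U → Matrix d d ℂ) (u v : U) (i j : d) :
    cqBlock ω (u, i) (v, j) = if u = v then ω u i j else 0 := by
  rw [cqBlock, Matrix.sum_apply, Finset.sum_eq_single u]
  · by_cases h : u = v <;> simp [ketbra, h]
  · intro w _ hw
    simp [ketbra, hw]
  · simp

theorem cqState_eq_cqBlock {d : Type*} (p : U → ℝ) (ρ : U → Matrix d d ℂ) :
    cqState p ρ = cqBlock (fun u => p u • ρ u) :=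
  Finset.sum_congr rfl fun _ _ => (Matrix.kronecker_smul _ _ _).symm

theorem diagBlock_cqBlock {d : Type*} (ω : U → Matrix d d ℂ) (u : U) :
    diagBlock (cqBlock ω) u = ω u := by
  ext i j
  simp [diagBlock, cqBlock_apply]

theorem one_sub_cqBlock {d : Type*} [DecidableEq d] (T : U → Matrix d d ℂ) :
    1 - cqBlock T = cqBlock (fun u => 1 - T u) := by
  ext ⟨u, i⟩ ⟨v, j⟩
  by_cases h : u = v <;> simp [cqBlock_apply, Matrix.one_apply, h]

theorem cqBlock_nonneg {d : Type*} [Finite d] {ω : U → Matrix d d ℂ} (hω : ∀ u, 0 ≤ ω u) :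
    0 ≤ cqBlock ω := by
  refine Finset.sum_nonneg fun u _ => Matrix.PosSemidef.nonneg ?_
  refine Matrix.PosSemidef.kronecker ?_ (Matrix.nonneg_iff_posSemidef.mp (hω u))
  rw [ketbra, ← Matrix.diagonal_single]
  exact .diagonal (Pi.single_nonneg.mpr zero_le_one)

theorem cqBlock_mem_Icc {d : Type*} [Finite d] [DecidableEq d] {T : U → Matrix d d ℂ}
    (hT : ∀ u, T u ∈ Set.Icc 0 1) : cqBlock T ∈ Set.Icc 0 1 := by
  refine ⟨cqBlock_nonneg fun u => (hT u).1, ?_⟩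
  rw [← sub_nonneg, one_sub_cqBlock]
  exact cqBlock_nonneg fun u => sub_nonneg.mpr (hT u).2

variable {d : Type*} [Fintype d] {ω : U → Matrix d d ℂ}

theorem re_trace_mul_cqBlock (T : Matrix (U × d) (U × d) ℂ) (ω : U → Matrix d d ℂ) :
    (T * cqBlock ω).trace.re = ∑ u, (diagBlock T u * ω u).trace.re := by
  rw [← Complex.re_sum]
  congr 1
  simp only [Matrix.trace, Matrix.diag_apply, Matrix.mul_apply, Fintype.sum_prod_type,
    cqBlock_apply, mul_ite, mul_zero, diagBlock, Matrix.submatrix_apply]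
  refine Finset.sum_congr rfl fun u _ => Finset.sum_congr rfl fun i _ => ?_
  rw [Finset.sum_comm]
  exact Finset.sum_congr rfl fun j _ => by simp

theorem traceSnd_kronecker_traceFst_cqBlock (hω : ∀ u, 0 ≤ ω u) :
    traceSnd (cqBlock ω) ⊗ₖ traceFst (cqBlock ω)
      = cqBlock (fun u => (ω u).trace.re • ∑ v, ω v) := by
  ext ⟨u, i⟩ ⟨v, j⟩
  simp only [Matrix.kronecker_apply, traceSnd, traceFst, Matrix.of_apply, cqBlock_apply]
  by_cases h : u = v
  · subst h
    simp only [if_true]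
    rw [Matrix.smul_apply, Complex.real_smul, coe_re_trace (hω u), Matrix.sum_apply]
    rfl
  · simp [h]

theorem IsEnsemble.re_trace_cqBlock (hω : IsEnsemble ω) : (cqBlock ω).trace.re = 1 := by
  classical
  rw [← Matrix.one_mul (cqBlock ω), re_trace_mul_cqBlock]
  simpa only [diagBlock_one, Matrix.one_mul] using hω.sum_trace

theorem IsEnsemble.marginalProduct_nonneg (hω : IsEnsemble ω) :
    0 ≤ cqBlock (fun u => (ω u).trace.re • ∑ v, ω v) :=
  cqBlock_nonneg fun u => smul_nonneg (re_trace_nonneg (hω.nonneg u)) hω.sum_nonneg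

variable [DecidableEq d]

theorem IsEnsemble.miAccept_le_one (hω : IsEnsemble ω) (c : ℝ) : miAccept (cqBlock ω) c ≤ 1 :=
  hω.re_trace_cqBlock ▸
    re_trace_mul_le_re_trace (nonnegProj_mem_Icc _).2 (cqBlock_nonneg hω.nonneg)

theorem IsEnsemble.exists_blockTest (hω : IsEnsemble ω) {c : ℝ} (hc : 0 < c) :
    ∃ P : U → Matrix d d ℂ, (∀ u, P u ∈ Set.Icc 0 1) ∧
      ∑ u, ((1 - P u) * ω u).trace.re = 1 - miAccept (cqBlock ω) c ∧
      ∑ u, (ω u).trace.re * (P u * ∑ v, ω v).trace.re ≤ c⁻¹ := by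
  set T := nonnegProj (cqBlock ω - c • (traceSnd (cqBlock ω) ⊗ₖ traceFst (cqBlock ω))) with hT
  refine ⟨diagBlock T, diagBlock_mem_Icc (nonnegProj_mem_Icc _), ?_, ?_⟩
  · simp only [re_trace_one_sub_mul, Finset.sum_sub_distrib, hω.sum_trace, miAccept,
      re_trace_mul_cqBlock, ← hT]
  · have h := re_trace_nonnegProj_sub_smul_mul_le_inv (cqBlock_nonneg hω.nonneg)
      hω.re_trace_cqBlock.le hω.marginalProduct_nonneg.isSelfAdjoint hc
    rw [← traceSnd_kronecker_traceFst_cqBlock hω.nonneg, ← hT,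
      traceSnd_kronecker_traceFst_cqBlock hω.nonneg, re_trace_mul_cqBlock] at h
    simpa only [re_trace_mul_smul] using h

theorem IsEnsemble.blockTest_le_miAccept (hω : IsEnsemble ω) {T : U → Matrix d d ℂ}
    (hT : ∀ u, T u ∈ Set.Icc 0 1) {c : ℝ} (hc : 0 ≤ c) :
    ∑ u, (T u * ω u).trace.re - c * ∑ u, (ω u).trace.re * (T u * ∑ v, ω v).trace.re
      ≤ miAccept (cqBlock ω) c := by
  have h := le_re_trace_nonnegProj_sub_smul_mul (cqBlock_nonneg hω.nonneg).isSelfAdjoint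
    hω.marginalProduct_nonneg (cqBlock_mem_Icc hT) hc
  rw [← traceSnd_kronecker_traceFst_cqBlock hω.nonneg, ← miAccept,
    traceSnd_kronecker_traceFst_cqBlock hω.nonneg] at h
  simpa only [re_trace_mul_cqBlock, diagBlock_cqBlock, re_trace_mul_smul] using h

end Ensemble

/-! ### Random codebooks -/

section Codebook

variable {U I : Type*} [Fintype U] [Fintype I] [DecidableEq I]

/-- Expectation of `F` over a codebook `I → U` with independent entries distributed as `p`. -/
def codebookMean (p : U → ℝ) (F : (I → U) → ℝ) : ℝ :=
  ∑ c, (∏ i, p (c i)) * F c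

variable {p : U → ℝ}

theorem codebookMean_add (F G : (I → U) → ℝ) :
    codebookMean p (fun c => F c + G c) = codebookMean p F + codebookMean p G := by
  simp only [codebookMean, mul_add, Finset.sum_add_distrib]

theorem codebookMean_const_mul (a : ℝ) (F : (I → U) → ℝ) :
    codebookMean p (fun c => a * F c) = a * codebookMean p F := by
  simp only [codebookMean, Finset.mul_sum, mul_left_comm]

theorem codebookMean_sum {J : Type*} (s : Finset J) (F : J → (I → U) → ℝ) :
    codebookMean p (fun c => ∑ j ∈ s, F j c) = ∑ j ∈ s, codebookMean p (F j) := by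
  simp only [codebookMean, Finset.mul_sum]
  exact Finset.sum_comm

theorem codebookMean_mono (hp : ∀ u, 0 ≤ p u) {F G : (I → U) → ℝ} (h : ∀ c, F c ≤ G c) :
    codebookMean p F ≤ codebookMean p G :=
  Finset.sum_le_sum fun c _ =>
    mul_le_mul_of_nonneg_left (h c) (Finset.prod_nonneg fun i _ => hp (c i))

theorem codebookMean_prod (h : I → U → ℝ) :
    codebookMean p (fun c => ∏ i, h i (c i)) = ∏ i, ∑ u, p u * h i u := by
  simp only [codebookMean, ← Finset.prod_mul_distrib]
  exact (Fintype.prod_sum fun i u => p u * h i u).symm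

theorem codebookMean_const (hp : ∑ u, p u = 1) (a : ℝ) :
    codebookMean p (fun _ : I → U => a) = a := by
  have h1 := codebookMean_prod (p := p) (fun (_ : I) (_ : U) => (1 : ℝ))
  simp only [mul_one, hp, Finset.prod_const_one] at h1
  simpa only [mul_one, h1] using codebookMean_const_mul (p := p) a (fun _ : I → U => 1)

theorem codebookMean_coord (hp : ∑ u, p u = 1) (i : I) (f : U → ℝ) :
    codebookMean p (fun c => f (c i)) = ∑ u, p u * f u := by
  have h := codebookMean_prod (p := p) (fun k u => if k = i then f u else 1)
  rw [Fintype.prod_eq_single i fun k hk => by simp [hk, hp]] at h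
  simpa only [Finset.prod_ite_eq', Finset.mem_univ, if_true] using h

theorem codebookMean_coord_mul_coord (hp : ∑ u, p u = 1) {i j : I} (hij : i ≠ j) (f g : U → ℝ) :
    codebookMean p (fun c => f (c i) * g (c j)) = (∑ u, p u * f u) * ∑ u, p u * g u := by
  have h := codebookMean_prod (p := p)
    (fun k u => (if k = i then f u else 1) * (if k = j then g u else 1))
  rw [Fintype.prod_eq_mul i j hij fun k hk => by simp [hk.1, hk.2, hp]] at h
  simpa only [Finset.prod_mul_distrib, Finset.prod_ite_eq', Finset.mem_univ, if_true, if_neg hij,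
    if_neg hij.symm, mul_one, one_mul] using h

theorem codebookMean_coord_pair (hp : ∑ u, p u = 1) {i j : I} (hij : i ≠ j) (f : U → U → ℝ) :
    codebookMean p (fun c => f (c i) (c j)) = ∑ u, ∑ v, p u * p v * f u v := by
  classical
  have hsplit (c : I → U) :
      f (c i) (c j) = ∑ u, (if c i = u then 1 else 0) * f u (c j) := by simp
  simp only [hsplit, codebookMean_sum]
  refine Finset.sum_congr rfl fun u _ => ?_
  rw [codebookMean_coord_mul_coord hp hij (fun w => if w = u then 1 else 0) (f u)]
  simp [Finset.mul_sum, mul_assoc]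

theorem exists_le_of_codebookMean_le (hp : p ∈ stdSimplex ℝ U) {F : (I → U) → ℝ} {K : ℝ}
    (h : codebookMean p F ≤ K) : ∃ c, F c ≤ K := by
  rcases isEmpty_or_nonempty U with hU | hU
  · simpa using hp.2
  · obtain ⟨c, hc⟩ := Finite.exists_min F
    refine ⟨c, le_trans ?_ h⟩
    rw [← codebookMean_const (I := I) hp.2 (F c)]
    exact codebookMean_mono hp.1 hc

variable {J : Type*} [Fintype J]

theorem codebookMean_average_le [Nonempty J] {F : J → (I → U) → ℝ} {a : ℝ}
    (h : ∀ j, codebookMean p (F j) ≤ a) :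
    codebookMean p (fun c => (∑ j, F j c) / Fintype.card J) ≤ a := by
  simp only [div_eq_inv_mul, codebookMean_const_mul, codebookMean_sum]
  rw [inv_mul_le_iff₀ (by positivity), ← nsmul_eq_mul]
  exact Finset.sum_le_card_nsmul _ _ _ fun j _ => h j

variable {e : J → I}

theorem codebookMean_sq_sum (hp : ∑ u, p u = 1) (he : e.Injective) {g : U → ℝ}
    (hg : ∑ u, p u * g u = 0) :
    codebookMean p (fun c => (∑ j, g (c (e j))) ^ 2) = Fintype.card J * ∑ u, p u * g u ^ 2 := by
  classical
  have hcov (j j' : J) : codebookMean p (fun c => g (c (e j)) * g (c (e j')))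
      = if j = j' then ∑ u, p u * g u ^ 2 else 0 := by
    split_ifs with hj
    · simpa only [hj, pow_two] using codebookMean_coord hp (e j') (fun u => g u * g u)
    · rw [codebookMean_coord_mul_coord hp (he.ne hj), hg, zero_mul]
  simp only [pow_two (∑ _, _), Finset.sum_mul_sum, codebookMean_sum, hcov, Finset.sum_ite_eq,
    Finset.mem_univ, if_true, Finset.sum_const, Finset.card_univ, nsmul_eq_mul]

theorem sum_mul_sub_mean_sq_le (hp : ∑ u, p u = 1) (h : U → ℝ) :
    ∑ u, p u * (∑ v, p v * h v - h u) ^ 2 ≤ ∑ u, p u * h u ^ 2 := by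
  have hexpand (μ : ℝ) : ∑ u, p u * (μ - h u) ^ 2
      = ∑ u, p u * h u ^ 2 - 2 * μ * ∑ u, p u * h u + μ ^ 2 * ∑ u, p u := by
    simp only [Finset.mul_sum, ← Finset.sum_sub_distrib, ← Finset.sum_add_distrib]
    exact Finset.sum_congr rfl fun _ _ => by ring
  set μ := ∑ v, p v * h v
  rw [hexpand, hp]
  nlinarith [sq_nonneg μ]

theorem codebookMean_sq_mean_sub_empiricalMean_le [Nonempty J] (hp : ∑ u, p u = 1)
    (he : e.Injective) (h : U → ℝ) :
    codebookMean p (fun c => (∑ u, p u * h u - (∑ j, h (c (e j))) / Fintype.card J) ^ 2)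
      ≤ (∑ u, p u * h u ^ 2) / Fintype.card J := by
  set μ := ∑ u, p u * h u with hμ
  have hcen : ∑ u, p u * (μ - h u) = 0 := by
    simp only [mul_sub, Finset.sum_sub_distrib, ← Finset.sum_mul, hp, one_mul, ← hμ, sub_self]
  have hdev (c : I → U) : (μ - (∑ j, h (c (e j))) / Fintype.card J) ^ 2
      = (1 / (Fintype.card J : ℝ) ^ 2) * (∑ j, (μ - h (c (e j)))) ^ 2 := by
    simp only [Finset.sum_sub_distrib, Finset.sum_const, Finset.card_univ, nsmul_eq_mul]
    field_simp
  simp only [hdev, codebookMean_const_mul, codebookMean_sq_sum hp he hcen]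
  calc 1 / (Fintype.card J : ℝ) ^ 2 * (Fintype.card J * ∑ u, p u * (μ - h u) ^ 2)
      = (∑ u, p u * (μ - h u) ^ 2) / Fintype.card J := by field_simp
    _ ≤ _ := by gcongr ?_ / _; exact sum_mul_sub_mean_sq_le hp h

end Codebook

/-! ### Random coding with the square-root measurement -/

section RandomCoding

variable {d : Type*} [Fintype d] [DecidableEq d] {U I : Type*} [Fintype I] [DecidableEq I]

theorem squareRootMeas_error_le {P : I → Matrix d d ℂ} (hP : ∀ i, P i ∈ Set.Icc 0 1) {δ : ℝ}
    (hδ : 0 < δ) {ρ : Matrix d d ℂ} (hρ : 0 ≤ ρ) (hρ1 : ρ.trace.re ≤ 1) (i : I) :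
    ((1 - squareRootMeas P δ i) * ρ).trace.re ≤ 2 * ((1 - P i) * ρ).trace.re
      + 4 * ∑ j ∈ Finset.univ.erase i, (P j * ρ).trace.re + 4 * δ := by
  have h := re_trace_mul_le_re_trace_mul (one_sub_squareRootMeas_le hP hδ i) hρ
  rw [Matrix.add_mul, Matrix.trace_add, Complex.add_re, re_trace_smul_mul, re_trace_smul_mul,
    Matrix.add_mul, Matrix.trace_add, Complex.add_re, re_trace_sum_mul, re_trace_smul_mul,
    Matrix.one_mul] at h
  nlinarith

variable [Fintype U] {p : U → ℝ} {ρ : U → Matrix d d ℂ}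

theorem codebookMean_squareRootMeas_error_le (hp : p ∈ stdSimplex ℝ U) {P : U → Matrix d d ℂ}
    (hP : ∀ u, P u ∈ Set.Icc 0 1) (hρ : ∀ u, 0 ≤ ρ u) (hρ1 : ∀ u, (ρ u).trace.re ≤ 1) {δ : ℝ}
    (hδ : 0 < δ) (i : I) :
    codebookMean p (fun c => ((1 - squareRootMeas (fun j => P (c j)) δ i) * ρ (c i)).trace.re)
      ≤ 2 * ∑ u, p u * ((1 - P u) * ρ u).trace.re
        + 4 * (Fintype.card I * ∑ u, ∑ v, p u * p v * (P v * ρ u).trace.re) + 4 * δ := by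
  refine (codebookMean_mono hp.1 fun c =>
    squareRootMeas_error_le (fun j => hP (c j)) hδ (hρ (c i)) (hρ1 (c i)) i).trans ?_
  have hcross : ∀ j ∈ Finset.univ.erase i, codebookMean p (fun c => (P (c j) * ρ (c i)).trace.re)
      = ∑ u, ∑ v, p u * p v * (P v * ρ u).trace.re := fun j hj =>
    codebookMean_coord_pair hp.2 (Finset.ne_of_mem_erase hj).symm fun u v => (P v * ρ u).trace.re
  rw [codebookMean_add, codebookMean_add, codebookMean_const hp.2, codebookMean_const_mul,
    codebookMean_const_mul, codebookMean_sum, Finset.sum_congr rfl hcross, Finset.sum_const,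
    codebookMean_coord hp.2 i (fun u => ((1 - P u) * ρ u).trace.re), nsmul_eq_mul]
  have hcross0 : 0 ≤ ∑ u, ∑ v, p u * p v * (P v * ρ u).trace.re :=
    Finset.sum_nonneg fun u _ => Finset.sum_nonneg fun v _ =>
      mul_nonneg (mul_nonneg (hp.1 u) (hp.1 v)) (re_trace_mul_nonneg (hP v).1 (hρ u))
  gcongr
  exact Finset.card_le_univ _

theorem exists_test_codebookMean_squareRootMeas_error_le [DecidableEq U] (hp : p ∈ stdSimplex ℝ U)
    (hρ : ∀ u, 0 ≤ ρ u) (hρ1 : ∀ u, (ρ u).trace.re ≤ 1)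
    (htr : ∀ u, (p u • ρ u).trace.re = p u) {c : ℝ} (hc : 0 < c) :
    ∃ P : U → Matrix d d ℂ, (∀ u, 0 ≤ P u) ∧ ∀ {δ : ℝ}, 0 < δ → ∀ i : I,
      codebookMean p (fun x => ((1 - squareRootMeas (fun j => P (x j)) δ i) * ρ (x i)).trace.re)
        ≤ 2 * (1 - miAccept (cqState p ρ) c) + 4 * (Fintype.card I * c⁻¹) + 4 * δ := by
  obtain ⟨P, hP, hreject, hproduct⟩ := (isEnsemble_smul hp hρ htr).exists_blockTest hc
  refine ⟨P, fun u => (hP u).1, fun hδ i =>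
    (codebookMean_squareRootMeas_error_le hp hP hρ hρ1 hδ i).trans ?_⟩
  simp only [re_trace_mul_smul, htr, re_trace_mul_sum, ← cqState_eq_cqBlock] at hreject hproduct
  rw [hreject, Finset.sum_comm]
  gcongr
  refine le_trans (le_of_eq ?_) hproduct
  simp only [Finset.mul_sum]
  exact Finset.sum_congr rfl fun v _ => Finset.sum_congr rfl fun u _ => by ring

end RandomCoding

/-! ### Joint distributions and likelihood ratios -/

section JointDistribution

variable {U S : Type*} {q : U → S → ℝ}

/-- The marginal distribution of the first variable. -/
def marginalFst [Fintype S] (q : U → S → ℝ) (u : U) : ℝ := ∑ s, q u s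

/-- The marginal distribution of the second variable. -/
def marginalSnd [Fintype U] (q : U → S → ℝ) (s : S) : ℝ := ∑ u, q u s

theorem marginalFst_nonneg [Fintype S] (hq : ∀ u s, 0 ≤ q u s) (u : U) : 0 ≤ marginalFst q u :=
  Finset.sum_nonneg fun s _ => hq u s

theorem marginalSnd_nonneg [Fintype U] (hq : ∀ u s, 0 ≤ q u s) (s : S) : 0 ≤ marginalSnd q s :=
  Finset.sum_nonneg fun u _ => hq u s

theorem eq_zero_of_marginalFst_eq_zero [Fintype S] (hq : ∀ u s, 0 ≤ q u s) {u : U}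
    (hu : marginalFst q u = 0) (s : S) : q u s = 0 :=
  congrFun ((Fintype.sum_eq_zero_iff_of_nonneg (hq u)).mp hu) s

theorem eq_zero_of_marginalSnd_eq_zero [Fintype U] (hq : ∀ u s, 0 ≤ q u s) {s : S}
    (hs : marginalSnd q s = 0) (u : U) : q u s = 0 :=
  congrFun ((Fintype.sum_eq_zero_iff_of_nonneg fun u => hq u s).mp hs) u

theorem marginalFst_mul_inv_mul [Fintype S] (hq : ∀ u s, 0 ≤ q u s) (u : U) (s : S) :
    marginalFst q u * ((marginalFst q u)⁻¹ * q u s) = q u s := by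
  by_cases h : marginalFst q u = 0
  · rw [eq_zero_of_marginalFst_eq_zero hq h s, mul_zero, mul_zero]
  · rw [mul_inv_cancel_left₀ h]

variable [Fintype U] [Fintype S] {t : ℝ}

/-- The likelihood ratio `q(u,s) / (q(u) q(s))` of a joint distribution; by the convention
`x / 0 = 0` it vanishes where a marginal does. -/
noncomputable def likelihoodRatio (q : U → S → ℝ) (u : U) (s : S) : ℝ :=
  q u s / (marginalFst q u * marginalSnd q s)

/-- The likelihood ratio, set to zero where it exceeds `t`. -/
noncomputable def truncRatio (q : U → S → ℝ) (t : ℝ) (u : U) (s : S) : ℝ :=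
  if t < likelihoodRatio q u s then 0 else likelihoodRatio q u s

/-- The probability that the likelihood ratio exceeds `t`, whose asymptotics define
`spectralSupMI`. -/
noncomputable def ratioTail (q : U → S → ℝ) (t : ℝ) : ℝ :=
  ∑ u, ∑ s, if t < likelihoodRatio q u s then q u s else 0

theorem likelihoodRatio_nonneg (hq : ∀ u s, 0 ≤ q u s) (u : U) (s : S) :
    0 ≤ likelihoodRatio q u s :=
  div_nonneg (hq u s) (mul_nonneg (marginalFst_nonneg hq u) (marginalSnd_nonneg hq s))

theorem marginalSnd_mul_likelihoodRatio (hq : ∀ u s, 0 ≤ q u s) (u : U) (s : S) :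
    marginalSnd q s * likelihoodRatio q u s = (marginalFst q u)⁻¹ * q u s := by
  by_cases h : marginalSnd q s = 0
  · rw [h, eq_zero_of_marginalSnd_eq_zero hq h u, zero_mul, mul_zero]
  · rw [likelihoodRatio]; field_simp

theorem marginalSnd_mul_marginalFst_mul_likelihoodRatio (hq : ∀ u s, 0 ≤ q u s) (u : U) (s : S) :
    marginalSnd q s * (marginalFst q u * likelihoodRatio q u s) = q u s := by
  rw [mul_left_comm, marginalSnd_mul_likelihoodRatio hq, marginalFst_mul_inv_mul hq]

theorem truncRatio_le_likelihoodRatio (hq : ∀ u s, 0 ≤ q u s) (u : U) (s : S) :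
    truncRatio q t u s ≤ likelihoodRatio q u s := by
  unfold truncRatio
  split_ifs
  exacts [likelihoodRatio_nonneg hq u s, le_rfl]

theorem truncRatio_mem_Icc (hq : ∀ u s, 0 ≤ q u s) (ht : 0 ≤ t) (u : U) (s : S) :
    truncRatio q t u s ∈ Set.Icc 0 t := by
  unfold truncRatio
  split_ifs with h
  exacts [⟨le_rfl, ht⟩, ⟨likelihoodRatio_nonneg hq u s, not_lt.mp h⟩]

theorem sum_marginalFst_mul_truncRatio_le_one (hq : ∀ u s, 0 ≤ q u s) (s : S) :
    ∑ u, marginalFst q u * truncRatio q t u s ≤ 1 := by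
  calc ∑ u, marginalFst q u * truncRatio q t u s
      ≤ ∑ u, marginalFst q u * likelihoodRatio q u s := Finset.sum_le_sum fun u _ =>
        mul_le_mul_of_nonneg_left (truncRatio_le_likelihoodRatio hq u s)
          (marginalFst_nonneg hq u)
    _ ≤ ∑ u, q u s / marginalSnd q s := Finset.sum_le_sum fun u _ => by
        by_cases h : marginalFst q u = 0
        · simpa [h] using div_nonneg (hq u s) (marginalSnd_nonneg hq s)
        · rw [likelihoodRatio, mul_div_assoc', mul_div_mul_left _ _ h]
    _ ≤ 1 := by rw [← Finset.sum_div]; exact div_self_le_one _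

theorem sum_marginalSnd_mul_one_sub_truncRatio (hq : ∀ u s, 0 ≤ q u s) :
    ∑ s, marginalSnd q s * (1 - ∑ u, marginalFst q u * truncRatio q t u s) = ratioTail q t := by
  rw [ratioTail, Finset.sum_comm]
  refine Finset.sum_congr rfl fun s _ => ?_
  rw [mul_sub, mul_one, Finset.mul_sum, marginalSnd, ← Finset.sum_sub_distrib]
  refine Finset.sum_congr rfl fun u _ => ?_
  rw [← marginalSnd, truncRatio]
  split_ifs
  · simp
  · rw [marginalSnd_mul_marginalFst_mul_likelihoodRatio hq, sub_self]

end JointDistribution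

/-! ### Soft covering and the likelihood encoder -/

section Likelihood

variable {J : Type*} [Fintype J]

/-- The distribution of an index drawn proportionally to the weights `r`; it is uniform if the
weights sum to zero. -/
noncomputable def likelihood (r : J → ℝ) (j : J) : ℝ :=
  if ∑ k, r k = 0 then (Fintype.card J : ℝ)⁻¹ else r j / ∑ k, r k

variable {r : J → ℝ}

theorem likelihood_mem_stdSimplex [Nonempty J] (hr : ∀ j, 0 ≤ r j) :
    likelihood r ∈ stdSimplex ℝ J := by
  by_cases h : ∑ k, r k = 0
  · rw [show likelihood r = fun _ => (Fintype.card J : ℝ)⁻¹ from funext fun _ => if_pos h]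
    exact ⟨fun _ => by positivity, by simp⟩
  · rw [show likelihood r = fun j => r j / ∑ k, r k from funext fun _ => if_neg h]
    exact ⟨fun j => div_nonneg (hr j) (Finset.sum_nonneg fun k _ => hr k), by
      rw [← Finset.sum_div, div_self h]⟩

theorem sum_mul_likelihood (hr : ∀ j, 0 ≤ r j) (g : J → ℝ) :
    (∑ j, r j) * ∑ j, likelihood r j * g j = ∑ j, r j * g j := by
  by_cases h : ∑ k, r k = 0
  · simp [(Fintype.sum_eq_zero_iff_of_nonneg hr).mp h]
  · simp only [likelihood, h, if_false, Finset.mul_sum]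
    exact Finset.sum_congr rfl fun j _ => by field_simp

theorem sum_likelihood_mul_le [Nonempty J] (hr : ∀ j, 0 ≤ r j) {g : J → ℝ}
    (hg : ∀ j, g j ∈ Set.Icc 0 1) :
    ∑ j, likelihood r j * g j
      ≤ (∑ j, r j * g j) / Fintype.card J + max 0 (1 - (∑ j, r j) / Fintype.card J) := by
  obtain ⟨hw, hw1⟩ := likelihood_mem_stdSimplex hr
  set G := ∑ j, likelihood r j * g j
  set R := (∑ j, r j) / Fintype.card J
  have hG0 : 0 ≤ G := Finset.sum_nonneg fun j _ => mul_nonneg (hw j) (hg j).1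
  have hG1 : G ≤ 1 :=
    hw1 ▸ Finset.sum_le_sum fun j _ => mul_le_of_le_one_right (hw j) (hg j).2
  calc G = R * G + (1 - R) * G := by ring
    _ ≤ R * G + max 0 (1 - R) * G := by gcongr; exact le_max_right _ _
    _ ≤ R * G + max 0 (1 - R) := by
      gcongr; exact mul_le_of_le_one_right (le_max_left _ _) hG1
    _ = (∑ j, r j * g j) / Fintype.card J + max 0 (1 - R) := by
      rw [← sum_mul_likelihood hr g, div_mul_eq_mul_div]

end Likelihood

section SoftCovering

theorem max_zero_one_sub_le {μ x η : ℝ} (hμ : μ ≤ 1) (hη : 0 < η) :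
    max 0 (1 - x) ≤ (1 - μ) + η + η⁻¹ * (μ - x) ^ 2 := by
  have hsq : μ - x ≤ η + η⁻¹ * (μ - x) ^ 2 := by
    have h : 2 * (μ - x) ≤ η + η⁻¹ * (μ - x) ^ 2 := by
      have := mul_nonneg (inv_nonneg.mpr hη.le) (sq_nonneg (μ - x - η))
      have e : η⁻¹ * (μ - x - η) ^ 2 = η⁻¹ * (μ - x) ^ 2 - 2 * (μ - x) + η := by
        field_simp; ring
      linarith
    have : 0 ≤ η + η⁻¹ * (μ - x) ^ 2 := by positivity
    linarith
  have : 0 ≤ η⁻¹ * (μ - x) ^ 2 := by positivity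
  exact max_le (by linarith) (by linarith)

variable {U I J : Type*} [Fintype U] [Fintype I] [DecidableEq I] [Fintype J] [Nonempty J]
  {e : J → I} {t η : ℝ}

theorem codebookMean_covering_deficit_le {p : U → ℝ} (hp : p ∈ stdSimplex ℝ U)
    (he : e.Injective) {h : U → ℝ} (hh : ∀ u, h u ∈ Set.Icc 0 t) (hμ : ∑ u, p u * h u ≤ 1)
    (ht : 0 ≤ t) (hη : 0 < η) :
    codebookMean p (fun c => max 0 (1 - (∑ j, h (c (e j))) / Fintype.card J))
      ≤ (1 - ∑ u, p u * h u) + η + t / (Fintype.card J * η) := by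
  have hsecond : ∑ u, p u * h u ^ 2 ≤ t := by
    calc ∑ u, p u * h u ^ 2 ≤ ∑ u, t * (p u * h u) := Finset.sum_le_sum fun u _ => by
          rw [pow_two, mul_left_comm t]
          exact mul_le_mul_of_nonneg_left
            (mul_le_mul_of_nonneg_right (hh u).2 (hh u).1) (hp.1 u)
      _ ≤ t := by rw [← Finset.mul_sum]; exact mul_le_of_le_one_right ht hμ
  refine (codebookMean_mono hp.1 fun c => max_zero_one_sub_le hμ hη).trans ?_
  rw [codebookMean_add, codebookMean_const hp.2, codebookMean_const_mul]
  gcongr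
  calc η⁻¹ * codebookMean p
          (fun c => (∑ u, p u * h u - (∑ j, h (c (e j))) / Fintype.card J) ^ 2)
      ≤ η⁻¹ * (t / Fintype.card J) := by
        gcongr
        exact (codebookMean_sq_mean_sub_empiricalMean_le hp.2 he h).trans (by gcongr)
    _ = t / (Fintype.card J * η) := by field_simp

variable {S : Type*} [Fintype S] {q : U → S → ℝ}

theorem codebookMean_likelihoodRatio_deficit_le (hq : ∀ u s, 0 ≤ q u s)
    (hq1 : ∑ u, marginalFst q u = 1) (he : e.Injective) (ht : 0 ≤ t) (hη : 0 < η) :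
    codebookMean (marginalFst q) (fun c => ∑ s, marginalSnd q s *
        max 0 (1 - (∑ j, likelihoodRatio q (c (e j)) s) / Fintype.card J))
      ≤ ratioTail q t + η + t / (Fintype.card J * η) := by
  have hq2 : ∑ s, marginalSnd q s = 1 := by
    rw [← hq1]; exact Finset.sum_comm
  simp only [codebookMean_sum, codebookMean_const_mul]
  calc ∑ s, marginalSnd q s * codebookMean (marginalFst q) (fun c =>
          max 0 (1 - (∑ j, likelihoodRatio q (c (e j)) s) / Fintype.card J))
      ≤ ∑ s, marginalSnd q s * codebookMean (marginalFst q) (fun c =>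
          max 0 (1 - (∑ j, truncRatio q t (c (e j)) s) / Fintype.card J)) := by
        gcongr with s _
        · exact marginalSnd_nonneg hq s
        refine codebookMean_mono (marginalFst_nonneg hq) fun c => ?_
        gcongr
        exact truncRatio_le_likelihoodRatio hq _ s
    _ ≤ ∑ s, marginalSnd q s * ((1 - ∑ u, marginalFst q u * truncRatio q t u s) + η
          + t / (Fintype.card J * η)) := by
        gcongr with s _
        · exact marginalSnd_nonneg hq s
        exact codebookMean_covering_deficit_le ⟨marginalFst_nonneg hq, hq1⟩ he
          (h := fun u => truncRatio q t u s) (fun u => truncRatio_mem_Icc hq ht u s)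
          (sum_marginalFst_mul_truncRatio_le_one hq s) ht hη
    _ = ratioTail q t + η + t / (Fintype.card J * η) := by
        simp only [add_assoc, mul_add, Finset.sum_add_distrib, ← Finset.sum_mul, hq2, one_mul,
          sum_marginalSnd_mul_one_sub_truncRatio hq]

end SoftCovering

/-! ### One-shot achievability -/

section Achievability

variable {d : Type*} [Fintype d]

theorem IsDensity.nonneg {ρ : Matrix d d ℂ} (hρ : IsDensity ρ) : 0 ≤ ρ := hρ.1.nonneg

theorem IsDensity.re_trace {ρ : Matrix d d ℂ} (hρ : IsDensity ρ) : ρ.trace.re = 1 := by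
  rw [hρ.2, Complex.one_re]

theorem IsDensity.re_trace_smul {ρ : Matrix d d ℂ} (hρ : IsDensity ρ) (c : ℝ) :
    (c • ρ).trace.re = c := by
  rw [Matrix.trace_smul, Complex.smul_re, hρ.re_trace, smul_eq_mul, mul_one]

theorem IsDensity.isEnsemble_smul {U : Type*} [Fintype U] {p : U → ℝ} {ρ : U → Matrix d d ℂ}
    (hρ : ∀ u, IsDensity (ρ u)) (hp : p ∈ stdSimplex ℝ U) : IsEnsemble (fun u => p u • ρ u) :=
  CQ.isEnsemble_smul hp (fun u => (hρ u).nonneg) fun u => (hρ u).re_trace_smul _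

variable [DecidableEq d]

theorem IsDensity.re_trace_one_sub_mul_mem_Icc {ρ β : Matrix d d ℂ} (hρ : IsDensity ρ)
    (hβ : β ∈ Set.Icc 0 1) : ((1 - β) * ρ).trace.re ∈ Set.Icc 0 1 :=
  ⟨re_trace_mul_nonneg (sub_nonneg.mpr hβ.2) hρ.nonneg,
    hρ.re_trace ▸ re_trace_mul_le_re_trace (sub_le_self 1 hβ.1) hρ.nonneg⟩

variable {U K : Type*} [Fintype U] [DecidableEq U] [Fintype K] [Nonempty K]

theorem exists_codebook_error_le {p : U → ℝ} (hp : p ∈ stdSimplex ℝ U) {ρ : U → Matrix d d ℂ}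
    (hρ : ∀ u, IsDensity (ρ u)) {c δ : ℝ} (hc : 0 < c) (hδ : 0 < δ) :
    ∃ (x : K → U) (β : K → Matrix d d ℂ), (∀ k, 0 ≤ β k) ∧ ∑ k, β k = 1 ∧
      (∑ k, ((1 - β k) * ρ (x k)).trace.re) / Fintype.card K
        ≤ 2 * (1 - miAccept (cqState p ρ) c) + 4 * (Fintype.card K * c⁻¹) + 4 * δ := by
  classical
  obtain ⟨P, hP, herror⟩ := exists_test_codebookMean_squareRootMeas_error_le (I := K) hp
    (fun u => (hρ u).nonneg) (fun u => (hρ u).re_trace.le) (fun u => (hρ u).re_trace_smul _) hc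
  obtain ⟨x, hx⟩ := exists_le_of_codebookMean_le hp
    (codebookMean_average_le fun k => herror hδ k)
  obtain ⟨β, hβ, hβ1⟩ := exists_le_and_sum_eq_one
    (sum_squareRootMeas_le_one (fun k => hP (x k)) hδ)
  refine ⟨x, β, fun k => (squareRootMeas_nonneg (fun k => hP (x k)) k).trans (hβ k), hβ1,
    le_trans ?_ hx⟩
  gcongr (∑ k, ?_) / _ with k _
  exact re_trace_mul_le_re_trace_mul (sub_le_sub_left (hβ k) 1) (hρ (x k)).nonneg

end Achievability

section GelfandPinskerAchievability

variable {d U S : Type*} [Fintype S]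

/-- The output ensemble of a channel `σ` whose input pair `(u, s)` has joint distribution `q`,
indexed by `u`. -/
noncomputable def jointEnsemble (q : U → S → ℝ) (σ : U → S → Matrix d d ℂ) (u : U) : Matrix d d ℂ :=
  ∑ s, q u s • σ u s

/-- The output state given `u` of a channel `σ` whose input pair `(u, s)` has joint distribution
`q`; it is `0` if `u` has probability zero. -/
noncomputable def condState (q : U → S → ℝ) (σ : U → S → Matrix d d ℂ) (u : U) : Matrix d d ℂ :=
  (marginalFst q u)⁻¹ • jointEnsemble q σ u

variable {q : U → S → ℝ} {σ : U → S → Matrix d d ℂ}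

theorem marginalFst_smul_condState (hq : ∀ u s, 0 ≤ q u s) (u : U) :
    marginalFst q u • condState q σ u = jointEnsemble q σ u := by
  simp only [condState, jointEnsemble, Finset.smul_sum, smul_smul]
  exact Finset.sum_congr rfl fun s _ => by rw [marginalFst_mul_inv_mul hq]

variable [Fintype d]

theorem jointEnsemble_nonneg (hq : ∀ u s, 0 ≤ q u s) (hσ : ∀ u s, IsDensity (σ u s)) (u : U) :
    0 ≤ jointEnsemble q σ u :=
  Finset.sum_nonneg fun s _ => smul_nonneg (hq u s) (hσ u s).nonneg

theorem re_trace_jointEnsemble (hσ : ∀ u s, IsDensity (σ u s)) (u : U) :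
    (jointEnsemble q σ u).trace.re = marginalFst q u := by
  simp only [jointEnsemble, Matrix.trace_sum, Complex.re_sum, (hσ _ _).re_trace_smul, marginalFst]

theorem isEnsemble_jointEnsemble [Fintype U] (hq : ∀ u s, 0 ≤ q u s)
    (hq1 : ∑ u, marginalFst q u = 1) (hσ : ∀ u s, IsDensity (σ u s)) :
    IsEnsemble (jointEnsemble q σ) :=
  ⟨jointEnsemble_nonneg hq hσ, by simp only [re_trace_jointEnsemble hσ, hq1]⟩

theorem condState_nonneg (hq : ∀ u s, 0 ≤ q u s) (hσ : ∀ u s, IsDensity (σ u s)) (u : U) :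
    0 ≤ condState q σ u :=
  smul_nonneg (inv_nonneg.mpr (marginalFst_nonneg hq u)) (jointEnsemble_nonneg hq hσ u)

theorem re_trace_condState_le_one (hσ : ∀ u s, IsDensity (σ u s)) (u : U) :
    (condState q σ u).trace.re ≤ 1 := by
  rw [condState, Matrix.trace_smul, Complex.smul_re, re_trace_jointEnsemble hσ, smul_eq_mul]
  exact inv_mul_le_one

theorem re_trace_mul_condState (T : Matrix d d ℂ) (u : U) :
    (T * condState q σ u).trace.re
      = ∑ s, (marginalFst q u)⁻¹ * q u s * (T * σ u s).trace.re := by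
  rw [condState, jointEnsemble, re_trace_mul_smul, re_trace_mul_sum, Finset.mul_sum]
  simp only [re_trace_mul_smul, mul_assoc]

variable [Fintype U] [DecidableEq U] {J : Type*} [Fintype J]

/-- The likelihood encoder: given the codewords `x j` and the channel state `s`, it sends a
codeword drawn with probability proportional to the likelihood ratio of `(x j, s)`. -/
noncomputable def likelihoodEncoder (q : U → S → ℝ) (x : J → U) (s : S) : U → ℝ :=
  ∑ j, likelihood (fun i => likelihoodRatio q (x i) s) j • Pi.single (x j) 1

theorem likelihoodEncoder_mem_stdSimplex [Nonempty J] (hq : ∀ u s, 0 ≤ q u s) (x : J → U) (s : S) :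
    likelihoodEncoder q x s ∈ stdSimplex ℝ U := by
  obtain ⟨hw, hw1⟩ := likelihood_mem_stdSimplex fun j => likelihoodRatio_nonneg hq (x j) s
  exact (convex_stdSimplex ℝ U).sum_mem (fun j _ => hw j) hw1 fun j _ =>
    single_mem_stdSimplex ℝ (x j)

theorem sum_likelihoodEncoder_mul (x : J → U) (s : S) (f : U → ℝ) :
    ∑ u, likelihoodEncoder q x s u * f u
      = ∑ j, likelihood (fun i => likelihoodRatio q (x i) s) j * f (x j) := by
  simp only [likelihoodEncoder, Finset.sum_apply, Pi.smul_apply, smul_eq_mul, Finset.sum_mul]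
  rw [Finset.sum_comm]
  exact Finset.sum_congr rfl fun j _ => by simp [Pi.single_apply]

variable [DecidableEq d]

theorem likelihoodEncoder_error_le [Nonempty J] (hq : ∀ u s, 0 ≤ q u s)
    (hσ : ∀ u s, IsDensity (σ u s)) (x : J → U) {β : Matrix d d ℂ} (hβ : β ∈ Set.Icc 0 1)
    {Q : J → Matrix d d ℂ} (hQ : ∀ j, Q j ≤ β) :
    ∑ s, marginalSnd q s * ∑ u, likelihoodEncoder q x s u * ((1 - β) * σ u s).trace.re
      ≤ ∑ s, marginalSnd q s
            * max 0 (1 - (∑ j, likelihoodRatio q (x j) s) / Fintype.card J)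
        + (∑ j, ((1 - Q j) * condState q σ (x j)).trace.re) / Fintype.card J := by
  have hstate (s : S) :
      marginalSnd q s * ∑ u, likelihoodEncoder q x s u * ((1 - β) * σ u s).trace.re
        ≤ marginalSnd q s * max 0 (1 - (∑ j, likelihoodRatio q (x j) s) / Fintype.card J)
          + (∑ j, (marginalFst q (x j))⁻¹ * q (x j) s * ((1 - Q j) * σ (x j) s).trace.re)
            / Fintype.card J := by
    rw [sum_likelihoodEncoder_mul]
    refine (mul_le_mul_of_nonneg_left (sum_likelihood_mul_le
      (fun j => likelihoodRatio_nonneg hq (x j) s) fun j =>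
        (hσ (x j) s).re_trace_one_sub_mul_mem_Icc hβ) (marginalSnd_nonneg hq s)).trans ?_
    rw [mul_add, add_comm, mul_div_assoc', Finset.mul_sum]
    simp only [← mul_assoc, marginalSnd_mul_likelihoodRatio hq]
    gcongr _ + (∑ j, _ * ?_) / _ with j _
    · exact mul_nonneg (inv_nonneg.mpr (marginalFst_nonneg hq _)) (hq _ _)
    · exact re_trace_mul_le_re_trace_mul (sub_le_sub_left (hQ j) 1) (hσ _ _).nonneg
  refine (Finset.sum_le_sum fun s _ => hstate s).trans (le_of_eq ?_)
  rw [Finset.sum_add_distrib, ← Finset.sum_div, Finset.sum_comm (s := Finset.univ (α := S))]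
  simp only [re_trace_mul_condState]

variable {K : Type*} [Fintype K] [Nonempty K] [Nonempty J]

theorem exists_codebook_likelihoodEncoder_error_le (hq : ∀ u s, 0 ≤ q u s)
    (hq1 : ∑ u, marginalFst q u = 1) (hσ : ∀ u s, IsDensity (σ u s)) {t η c δ : ℝ} (ht : 0 ≤ t)
    (hη : 0 < η) (hc : 0 < c) (hδ : 0 < δ) :
    ∃ (x : K × J → U) (β : K → Matrix d d ℂ), (∀ k, 0 ≤ β k) ∧ ∑ k, β k = 1 ∧
      (∑ k, ∑ s, marginalSnd q s * ∑ u, likelihoodEncoder q (fun j => x (k, j)) s u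
          * ((1 - β k) * σ u s).trace.re) / Fintype.card K
        ≤ ratioTail q t + η + t / (Fintype.card J * η)
          + (2 * (1 - miAccept (cqBlock (jointEnsemble q σ)) c)
            + 4 * (Fintype.card (K × J) * c⁻¹) + 4 * δ) := by
  classical
  have hp : marginalFst q ∈ stdSimplex ℝ U := ⟨marginalFst_nonneg hq, hq1⟩
  obtain ⟨P, hP, herror⟩ := exists_test_codebookMean_squareRootMeas_error_le (I := K × J) hp
    (condState_nonneg hq hσ) (re_trace_condState_le_one hσ)
    (fun u => by rw [marginalFst_smul_condState hq, re_trace_jointEnsemble hσ]) hc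
  simp only [cqState_eq_cqBlock, marginalFst_smul_condState hq] at herror
  obtain ⟨x, hx⟩ := exists_le_of_codebookMean_le hp <| codebookMean_average_le fun k : K =>
    (codebookMean_add _ _).trans_le <| add_le_add
      (codebookMean_likelihoodRatio_deficit_le hq hq1 (Prod.mk_right_injective k) ht hη)
      (codebookMean_average_le fun j : J => herror hδ (k, j))
  set Q := squareRootMeas (fun i => P (x i)) δ
  have hQ : ∀ i, 0 ≤ Q i := squareRootMeas_nonneg fun i => hP (x i)
  obtain ⟨β, hβ, hβ1⟩ := exists_le_and_sum_eq_one (T := fun k => ∑ j, Q (k, j))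
    ((Fintype.sum_prod_type Q).symm.trans_le (sum_squareRootMeas_le_one (fun i => hP (x i)) hδ))
  have hβ0 (k : K) : 0 ≤ β k := (Finset.sum_nonneg fun j _ => hQ (k, j)).trans (hβ k)
  refine ⟨x, β, hβ0, hβ1, le_trans ?_ hx⟩
  gcongr with k _
  refine likelihoodEncoder_error_le hq hσ (fun j => x (k, j)) ⟨hβ0 k, ?_⟩ fun j => ?_
  · exact hβ1 ▸ Finset.single_le_sum (fun k _ => hβ0 k) (Finset.mem_univ k)
  · exact (Finset.single_le_sum (f := fun j => Q (k, j)) (fun j _ => hQ (k, j))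
      (Finset.mem_univ j)).trans (hβ k)

end GelfandPinskerAchievability

/-! ### Auxiliary inputs -/

section AuxInput

variable {X S B : Type*} [Fintype X] {n : ℕ}

/-- The channel from `(u, s)` to the output that an auxiliary input induces by drawing the
channel input from `p(x | u, s)`. -/
noncomputable def AuxInput.channel (a : AuxInput X S n)
    (ρ : (Fin n → X) → (Fin n → S) → Matrix (Fin n → B) (Fin n → B) ℂ) (u : Fin a.k)
    (s : Fin n → S) : Matrix (Fin n → B) (Fin n → B) ℂ :=
  ∑ x, a.pX u s x • ρ x s

theorem AuxInput.channel_isDensity [Fintype B] (a : AuxInput X S n)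
    {ρ : (Fin n → X) → (Fin n → S) → Matrix (Fin n → B) (Fin n → B) ℂ}
    (hρ : ∀ x s, IsDensity (ρ x s)) (u : Fin a.k) (s : Fin n → S) :
    IsDensity (a.channel ρ u s) := by
  refine ⟨Matrix.posSemidef_sum _ fun x _ => (hρ x s).1.smul ((a.pX_mem u s).1 x), ?_⟩
  simp only [channel, Matrix.trace_sum, Matrix.trace_smul, (hρ _ _).2]
  rw [← Finset.sum_smul, (a.pX_mem u s).2, one_smul]

theorem AuxInput.re_trace_mul_channel [Fintype B] (a : AuxInput X S n)
    (ρ : (Fin n → X) → (Fin n → S) → Matrix (Fin n → B) (Fin n → B) ℂ) (u : Fin a.k)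
    (s : Fin n → S) (T : Matrix (Fin n → B) (Fin n → B) ℂ) :
    (T * a.channel ρ u s).trace.re = ∑ x, a.pX u s x * (T * ρ x s).trace.re := by
  rw [channel, re_trace_mul_sum]
  simp only [re_trace_mul_smul]

theorem AuxInput.jointUS_nonneg (a : AuxInput X S n) {pS : (Fin n → S) → ℝ} (hS : ∀ s, 0 ≤ pS s)
    (u : Fin a.k) (s : Fin n → S) : 0 ≤ a.jointUS pS u s :=
  mul_nonneg (hS s) ((a.pU_mem s).1 u)

theorem AuxInput.marginalSnd_jointUS (a : AuxInput X S n) (pS : (Fin n → S) → ℝ) :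
    marginalSnd (a.jointUS pS) = pS := by
  funext s
  simp only [marginalSnd, jointUS, ← Finset.mul_sum, (a.pU_mem s).2, mul_one]

variable [Fintype S]

theorem AuxInput.sum_marginalFst_jointUS (a : AuxInput X S n) {pS : (Fin n → S) → ℝ}
    (hS : ∑ s, pS s = 1) : ∑ u, marginalFst (a.jointUS pS) u = 1 := by
  calc ∑ u, marginalFst (a.jointUS pS) u
      = ∑ s, marginalSnd (a.jointUS pS) s := Finset.sum_comm
    _ = 1 := by rw [a.marginalSnd_jointUS, hS]

theorem AuxInput.isEnsemble_jointEnsemble [Fintype B] (a : AuxInput X S n)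
    {ρ : (Fin n → X) → (Fin n → S) → Matrix (Fin n → B) (Fin n → B) ℂ}
    (hρ : ∀ x s, IsDensity (ρ x s)) {pS : (Fin n → S) → ℝ} (hS : pS ∈ stdSimplex ℝ (Fin n → S)) :
    IsEnsemble (jointEnsemble (a.jointUS pS) (a.channel ρ)) :=
  CQ.isEnsemble_jointEnsemble (a.jointUS_nonneg hS.1) (a.sum_marginalFst_jointUS hS.2)
    (a.channel_isDensity hρ)

variable [DecidableEq X] [DecidableEq S]

theorem AuxInput.theta_apply (a : AuxInput X S n)
    (ρ : (Fin n → X) → (Fin n → S) → Matrix (Fin n → B) (Fin n → B) ℂ) (pS : (Fin n → S) → ℝ)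
    (s s' : Fin n → S) (u u' : Fin a.k) (x x' : Fin n → X) (b b' : Fin n → B) :
    a.theta ρ pS (s, u, x, b) (s', u', x', b') = if s = s' ∧ u = u' ∧ x = x' then
      ((pS s * a.pU s u * a.pX u s x : ℝ) : ℂ) * ρ x s b b' else 0 := by
  simp only [theta, ketbra, Matrix.sum_apply, Matrix.smul_apply, Matrix.kronecker_apply,
    Matrix.single_apply, Complex.real_smul]
  rw [Fintype.sum_eq_single s fun r hr => by simp [hr],
    Fintype.sum_eq_single u fun v hv => by simp [hv],
    Fintype.sum_eq_single x fun y hy => by simp [hy]]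
  by_cases hs : s = s' <;> by_cases hu : u = u' <;> by_cases hx : x = x' <;> simp [hs, hu, hx]

theorem AuxInput.reduceUB_theta (a : AuxInput X S n)
    (ρ : (Fin n → X) → (Fin n → S) → Matrix (Fin n → B) (Fin n → B) ℂ) (pS : (Fin n → S) → ℝ) :
    reduceUB (a.theta ρ pS) = cqBlock (jointEnsemble (a.jointUS pS) (a.channel ρ)) := by
  ext ⟨u, b⟩ ⟨u', b'⟩
  rw [cqBlock_apply]
  simp only [reduceUB, Matrix.of_apply, a.theta_apply, true_and, and_true]
  split_ifs
  · simp only [jointEnsemble, channel, jointUS, Finset.smul_sum, smul_smul, Matrix.sum_apply,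
      Matrix.smul_apply, Complex.real_smul]
  · simp only [Finset.sum_const_zero]

end AuxInput

/-! ### One-shot codes -/

section Codes

variable {X S B : Type*} [Fintype X] [Fintype S] [Fintype B] [DecidableEq B] {n M : ℕ}

theorem CQCode.exists_error_le [DecidableEq X] {p : (Fin n → X) → ℝ}
    (hp : p ∈ stdSimplex ℝ (Fin n → X)) {ρ : (Fin n → X) → Matrix (Fin n → B) (Fin n → B) ℂ}
    (hρ : ∀ x, IsDensity (ρ x)) {c δ : ℝ} (hc : 0 < c) (hδ : 0 < δ) (hM : 0 < M) :
    ∃ C : CQCode X B n M, C.error ρ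
      ≤ 2 * (1 - miAccept (cqState p ρ) c) + 4 * (M * c⁻¹) + 4 * δ := by
  have : Nonempty (Fin M) := Fin.pos_iff_nonempty.mp hM
  obtain ⟨x, β, hβ, hβ1, herror⟩ := exists_codebook_error_le (K := Fin M) hp hρ hc hδ
  refine ⟨⟨fun m => Pi.single (x m) 1, fun m => single_mem_stdSimplex ℝ (x m), β,
    fun m => Matrix.nonneg_iff_posSemidef.mp (hβ m), hβ1⟩, ?_⟩
  simpa [CQCode.error, Pi.single_apply, div_eq_inv_mul] using herror

theorem GPCode.exists_error_le (a : AuxInput X S n) {pS : (Fin n → S) → ℝ}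
    (hS : pS ∈ stdSimplex ℝ (Fin n → S))
    {ρ : (Fin n → X) → (Fin n → S) → Matrix (Fin n → B) (Fin n → B) ℂ}
    (hρ : ∀ x s, IsDensity (ρ x s)) {c t η δ : ℝ} (hc : 0 < c) (ht : 0 ≤ t) (hη : 0 < η)
    (hδ : 0 < δ) {L : ℕ} (hM : 0 < M) (hL : 0 < L) :
    ∃ C : GPCode X S B n M, C.error ρ pS
      ≤ ratioTail (a.jointUS pS) t + η + t / (L * η)
        + (2 * (1 - miAccept (cqBlock (jointEnsemble (a.jointUS pS) (a.channel ρ))) c)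
          + 4 * (M * L * c⁻¹) + 4 * δ) := by
  have : Nonempty (Fin M) := Fin.pos_iff_nonempty.mp hM
  have : Nonempty (Fin L) := Fin.pos_iff_nonempty.mp hL
  have hq := a.jointUS_nonneg hS.1
  obtain ⟨x, β, hβ, hβ1, herror⟩ := exists_codebook_likelihoodEncoder_error_le (K := Fin M)
    (J := Fin L) hq (a.sum_marginalFst_jointUS hS.2) (a.channel_isDensity hρ) ht hη hc hδ
  set w := fun m s => likelihoodEncoder (a.jointUS pS) (fun j => x (m, j)) s
  have hw m s : w m s ∈ stdSimplex ℝ (Fin a.k) := likelihoodEncoder_mem_stdSimplex hq _ s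
  refine ⟨⟨fun m s => ∑ u, w m s u • a.pX u s, fun m s =>
    (convex_stdSimplex ℝ _).sum_mem (fun u _ => (hw m s).1 u) (hw m s).2 fun u _ => a.pX_mem u s,
    β, fun m => Matrix.nonneg_iff_posSemidef.mp (hβ m), hβ1⟩, ?_⟩
  have hchannel m s : ∑ y, (∑ u, w m s u • a.pX u s) y * ((1 - β m) * ρ y s).trace.re
      = ∑ u, w m s u * ((1 - β m) * a.channel ρ u s).trace.re := by
    simp only [a.re_trace_mul_channel, Finset.sum_apply, Pi.smul_apply, smul_eq_mul,
      Finset.sum_mul, Finset.mul_sum, mul_assoc]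
    exact Finset.sum_comm
  simpa only [GPCode.error, hchannel, a.marginalSnd_jointUS, Fintype.card_prod, Fintype.card_fin,
    Nat.cast_mul, div_eq_inv_mul, mul_one] using herror

end Codes

section Converse

variable {I : Type*} [Fintype I]

theorem sum_smul_mem_Icc_of_sum_eq_one {A : Type*} [AddCommGroup A] [One A] [PartialOrder A]
    [IsOrderedAddMonoid A] [Module ℝ A] [PosSMulMono ℝ A] [SMulPosMono ℝ A] {β : I → A}
    (hβ : ∀ i, 0 ≤ β i) (hβ1 : ∑ i, β i = 1) {w : I → ℝ} (hw : ∀ i, w i ∈ Set.Icc 0 1) :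
    ∑ i, w i • β i ∈ Set.Icc 0 1 :=
  ⟨Finset.sum_nonneg fun i _ => smul_nonneg (hw i).1 (hβ i), hβ1 ▸ Finset.sum_le_sum fun i _ =>
    smul_le_of_le_one_left (hβ i) (hw i).2⟩

variable {d U : Type*} [Fintype d] [DecidableEq d] [Fintype U] [DecidableEq U]

/- With `w u i` the posterior probability of the message `i` given `u`, the test `∑ i, w u i • β i`
accepts the state with the probability of correct decoding. On the product of its marginals the
decoded message is independent of `u`, and is correct with probability at most `κ`. -/
theorem IsEnsemble.sum_povm_sub_le_miAccept {ω : U → Matrix d d ℂ} (hω : IsEnsemble ω)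
    {β : I → Matrix d d ℂ} (hβ : ∀ i, 0 ≤ β i) (hβ1 : ∑ i, β i = 1) {w : U → I → ℝ}
    (hw : ∀ u i, w u i ∈ Set.Icc 0 1) {κ : ℝ} (hκ : ∀ i, ∑ u, (ω u).trace.re * w u i ≤ κ) {c : ℝ}
    (hc : 0 ≤ c) :
    ∑ u, ∑ i, w u i * (β i * ω u).trace.re - c * κ ≤ miAccept (cqBlock ω) c := by
  have hT u := sum_smul_mem_Icc_of_sum_eq_one hβ hβ1 (hw u)
  have hmean : (∑ v, ω v).trace.re = 1 := by rw [Matrix.trace_sum, Complex.re_sum, hω.sum_trace]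
  refine le_trans ?_ (hω.blockTest_le_miAccept hT hc)
  have hmean0 := hω.sum_nonneg
  set τ := ∑ v, ω v
  simp only [re_trace_sum_mul, re_trace_smul_mul]
  gcongr
  calc ∑ u, (ω u).trace.re * ∑ i, w u i * (β i * τ).trace.re
      = ∑ i, (∑ u, (ω u).trace.re * w u i) * (β i * τ).trace.re := by
        simp only [Finset.mul_sum, Finset.sum_mul, mul_assoc]
        exact Finset.sum_comm
    _ ≤ ∑ i, κ * (β i * τ).trace.re := Finset.sum_le_sum fun i _ =>
        mul_le_mul_of_nonneg_right (hκ i) (re_trace_mul_nonneg (hβ i) hmean0)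
    _ = κ := by
        rw [← Finset.mul_sum, ← re_trace_sum_mul, hβ1, Matrix.one_mul, hmean, mul_one]

variable {X S B : Type*} [Fintype X] [Fintype B] [DecidableEq B] {n M : ℕ}

theorem CQCode.one_sub_error (C : CQCode X B n M) (hM : 0 < M)
    {ρ : (Fin n → X) → Matrix (Fin n → B) (Fin n → B) ℂ} (hρ : ∀ x, IsDensity (ρ x)) :
    1 - C.error ρ = ∑ m, ∑ x, 1 / M * C.enc m x * (C.dec m * ρ x).trace.re := by
  have : (M : ℝ) ≠ 0 := by positivity
  simp only [CQCode.error, re_trace_one_sub_mul, (hρ _).re_trace, mul_sub, mul_one,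
    Finset.sum_sub_distrib, (C.enc_mem _).2, Finset.sum_const, Finset.card_univ, Fintype.card_fin,
    nsmul_eq_mul, one_div_mul_cancel this, sub_sub_cancel, Finset.mul_sum, mul_assoc]

theorem CQCode.exists_input_le_miAccept [DecidableEq X] (C : CQCode X B n M) (hM : 0 < M)
    {ρ : (Fin n → X) → Matrix (Fin n → B) (Fin n → B) ℂ} (hρ : ∀ x, IsDensity (ρ x)) :
    ∃ p : stdSimplex ℝ (Fin n → X), ∀ c : ℝ, 0 ≤ c →
      1 - C.error ρ - c / M ≤ miAccept (cqState (p : (Fin n → X) → ℝ) ρ) c := by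
  set q : (Fin n → X) → Fin M → ℝ := fun x m => 1 / M * C.enc m x
  have hq x m : 0 ≤ q x m := mul_nonneg (by positivity) ((C.enc_mem m).1 x)
  have hqm m : ∑ x, q x m = 1 / M := by
    simp only [q, ← Finset.mul_sum, (C.enc_mem m).2, mul_one]
  have hq1 : ∑ x, marginalFst q x = 1 := by
    have : (M : ℝ) ≠ 0 := by positivity
    simp only [marginalFst]
    rw [Finset.sum_comm]
    simp [hqm, this]
  refine ⟨⟨marginalFst q, marginalFst_nonneg hq, hq1⟩, fun c hc => ?_⟩
  have hle x m : q x m ≤ marginalFst q x :=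
    Finset.single_le_sum (fun m _ => hq x m) (Finset.mem_univ m)
  have hp := marginalFst_nonneg hq
  have h := (IsDensity.isEnsemble_smul hρ ⟨hp, hq1⟩).sum_povm_sub_le_miAccept
    (fun m => (C.dec_pos m).nonneg) C.dec_sum (w := fun x m => (marginalFst q x)⁻¹ * q x m)
    (fun x m => ⟨mul_nonneg (inv_nonneg.mpr (hp x)) (hq x m),
        (mul_le_mul_of_nonneg_left (hle x m) (inv_nonneg.mpr (hp x))).trans inv_mul_le_one⟩)
    (κ := 1 / M) (fun m => by
      simp only [(hρ _).re_trace_smul, marginalFst_mul_inv_mul hq, hqm, le_refl]) hc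
  have hcorrect : 1 - C.error ρ = ∑ x, ∑ m, q x m * (C.dec m * ρ x).trace.re := by
    rw [C.one_sub_error hM hρ, Finset.sum_comm]
  have hposterior x m (r : ℝ) :
      (marginalFst q x)⁻¹ * q x m * (marginalFst q x * r) = q x m * r := by
    rw [← mul_assoc, mul_comm _ (marginalFst q x), marginalFst_mul_inv_mul hq]
  change 1 - C.error ρ - c / M ≤ miAccept (cqState (marginalFst q) ρ) c
  rw [cqState_eq_cqBlock, hcorrect]
  simpa only [re_trace_mul_smul, hposterior, mul_one_div] using h

/-- The auxiliary input of a code: `u` is a uniformly drawn message, encoded by the code. -/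
noncomputable abbrev GPCode.auxInput (C : GPCode X S B n M) (hM : 0 < M) : AuxInput X S n where
  k := M
  pU _ _ := 1 / M
  pU_mem _ := ⟨fun _ => by positivity, by simp [hM.ne']⟩
  pX := C.enc
  pX_mem := C.enc_mem

theorem GPCode.jointUS_auxInput (C : GPCode X S B n M) (hM : 0 < M) (pS : (Fin n → S) → ℝ) :
    (C.auxInput hM).jointUS pS = fun _ s => 1 / (M : ℝ) * pS s :=
  funext₂ fun _ _ => mul_comm _ _

variable [Fintype S]

theorem GPCode.marginalFst_jointUS_auxInput (C : GPCode X S B n M) (hM : 0 < M)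
    {pS : (Fin n → S) → ℝ} (hS : ∑ s, pS s = 1) :
    marginalFst ((C.auxInput hM).jointUS pS) = fun _ => 1 / (M : ℝ) := by
  funext u
  simp only [C.jointUS_auxInput hM, marginalFst, ← Finset.mul_sum, hS, mul_one]

theorem GPCode.one_sub_error (C : GPCode X S B n M) (hM : 0 < M)
    {ρ : (Fin n → X) → (Fin n → S) → Matrix (Fin n → B) (Fin n → B) ℂ}
    (hρ : ∀ x s, IsDensity (ρ x s)) {pS : (Fin n → S) → ℝ} (hS : ∑ s, pS s = 1) :
    1 - C.error ρ pS
      = ∑ m, (C.dec m * jointEnsemble ((C.auxInput hM).jointUS pS)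
          ((C.auxInput hM).channel ρ) m).trace.re := by
  have : (M : ℝ) ≠ 0 := by positivity
  have hcorrect (m : Fin M) : (C.dec m * jointEnsemble ((C.auxInput hM).jointUS pS)
      ((C.auxInput hM).channel ρ) m).trace.re
        = 1 / M * ∑ s, pS s * ∑ x, C.enc m s x * (C.dec m * ρ x s).trace.re := by
    simp only [C.jointUS_auxInput hM, jointEnsemble, re_trace_mul_sum, re_trace_mul_smul,
      (C.auxInput hM).re_trace_mul_channel]
    simp only [Finset.mul_sum, mul_assoc]
  simp only [GPCode.error, re_trace_one_sub_mul, (hρ _ _).re_trace, mul_sub, mul_one,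
    Finset.sum_sub_distrib, (C.enc_mem _ _).2, hS, Finset.sum_const, Finset.card_univ,
    Fintype.card_fin, nsmul_eq_mul, one_div_mul_cancel this, sub_sub_cancel, hcorrect,
    Finset.mul_sum]

theorem GPCode.one_sub_error_sub_le_miAccept (C : GPCode X S B n M) (hM : 0 < M)
    {ρ : (Fin n → X) → (Fin n → S) → Matrix (Fin n → B) (Fin n → B) ℂ}
    (hρ : ∀ x s, IsDensity (ρ x s)) {pS : (Fin n → S) → ℝ} (hS : pS ∈ stdSimplex ℝ (Fin n → S))
    {c : ℝ} (hc : 0 ≤ c) :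
    1 - C.error ρ pS - c / M ≤ miAccept (cqBlock (jointEnsemble ((C.auxInput hM).jointUS pS)
      ((C.auxInput hM).channel ρ))) c := by
  have h := ((C.auxInput hM).isEnsemble_jointEnsemble hρ hS).sum_povm_sub_le_miAccept
    (fun m => (C.dec_pos m).nonneg) C.dec_sum (w := fun u m => if u = m then 1 else 0)
    (fun u m => by split_ifs <;> simp) (κ := 1 / M) (fun m => by
      simp [re_trace_jointEnsemble ((C.auxInput hM).channel_isDensity hρ),
        C.marginalFst_jointUS_auxInput hM hS.2]) hc
  simpa only [ite_mul, one_mul, zero_mul, Finset.sum_ite_eq, Finset.mem_univ, if_true,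
    mul_one_div, ← C.one_sub_error hM hρ hS.2] using h

end Converse

/-! ### Achievable rates -/

section AchievableRate

theorem exists_tendsto_zero_of_forall_eventually {P : ℕ → ℝ → Prop}
    (h : ∀ ε : ℝ, 0 < ε → ∀ᶠ n in atTop, P n ε) :
    ∃ e : ℕ → ℝ, Tendsto e atTop (𝓝 0) ∧ ∀ᶠ n in atTop, P n (e n) := by
  classical
  have hP (k : ℕ) : ∀ᶠ n in atTop, P n (1 / ((k : ℝ) + 1)) := h _ (by positivity)
  set k : ℕ → ℕ := fun n => Nat.findGreatest (fun k => P n (1 / ((k : ℝ) + 1))) n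
  have hk : Tendsto k atTop atTop := tendsto_atTop.mpr fun K => by
    filter_upwards [hP K, eventually_ge_atTop K] with n hn hKn
    exact Nat.le_findGreatest hKn hn
  refine ⟨fun n => 1 / ((k n : ℝ) + 1),
    (tendsto_one_div_add_atTop_nhds_zero_nat (𝕜 := ℝ)).comp hk, ?_⟩
  filter_upwards [hP 0] with n hn
  exact Nat.findGreatest_spec (P := fun k => P n (1 / ((k : ℝ) + 1))) (Nat.zero_le n) hn

theorem tendsto_two_rpow_neg {γ : ℝ} (hγ : 0 < γ) :
    Tendsto (fun n : ℕ => (2 : ℝ) ^ ((n : ℝ) * (-γ))) atTop (𝓝 0) := by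
  have hpow (n : ℕ) : (2 : ℝ) ^ ((n : ℝ) * (-γ)) = ((2 : ℝ) ^ (-γ)) ^ n := by
    rw [mul_comm, Real.rpow_mul_natCast zero_le_two]
  simp only [hpow]
  exact tendsto_pow_atTop_nhds_zero_of_lt_one (by positivity)
    (Real.rpow_lt_one_of_one_lt_of_neg one_lt_two (neg_lt_zero.mpr hγ))

theorem two_rpow_le_iff_le_rate {n M : ℕ} (hn : 0 < n) (hM : 0 < M) {R : ℝ} :
    (2 : ℝ) ^ ((n : ℝ) * R) ≤ M ↔ R ≤ 1 / (n : ℝ) * Real.logb 2 M := by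
  rw [← Real.le_logb_iff_rpow_le one_lt_two (Nat.cast_pos.mpr hM), one_div, ← div_eq_inv_mul,
    le_div_iff₀' (Nat.cast_pos.mpr hn)]

theorem ceil_two_rpow_pos (x : ℝ) : 0 < ⌈(2 : ℝ) ^ x⌉₊ :=
  Nat.ceil_pos.mpr (by positivity)

theorem ceil_two_rpow_le {x : ℝ} (hx : 0 ≤ x) : (⌈(2 : ℝ) ^ x⌉₊ : ℝ) ≤ 2 * (2 : ℝ) ^ x := by
  have h1 := (Nat.ceil_lt_add_one (by positivity : (0 : ℝ) ≤ (2 : ℝ) ^ x)).le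
  have h2 : (1 : ℝ) ≤ (2 : ℝ) ^ x := Real.one_le_rpow one_le_two hx
  linarith

theorem mul_inv_two_rpow_le {K C x y z : ℝ} (hK : K ≤ C * (2 : ℝ) ^ x) (h : x - y = z) :
    K * ((2 : ℝ) ^ y)⁻¹ ≤ C * (2 : ℝ) ^ z := by
  rwa [← div_eq_mul_inv, div_le_iff₀ (by positivity), mul_assoc, ← Real.rpow_add two_pos, ← h,
    sub_add_cancel]

/-- Achievability of a rate, as in `CQAchievable` and `GPAchievable`, for an arbitrary notion of
code: `Code n M` are the codes with `M` messages and block length `n`, and `err` is their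
probability of error. -/
def IsAchievableRate (Code : ℕ → ℕ → Type*) (err : ∀ n M, Code n M → ℝ) (R : ℝ) : Prop :=
  ∀ ε : ℝ, 0 < ε → ∃ (M : ℕ → ℕ) (e : ℕ → ℝ) (c : ∀ n, Code n (M n)),
    (∀ n, 0 < M n) ∧ (∀ n, err n (M n) (c n) ≤ e n) ∧
    (R : EReal) < liminf (fun n : ℕ => ((1 / (n : ℝ) * Real.logb 2 (M n) : ℝ) : EReal)) atTop ∧
    limsup (fun n : ℕ => (e n : EReal)) atTop < (ε : EReal)

variable {Code : ℕ → ℕ → Type*} {err : ∀ n M, Code n M → ℝ} {R : ℝ}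

theorem limsup_coe_lt_of_tendsto_zero {e : ℕ → ℝ} (he : Tendsto e atTop (𝓝 0)) {ε : ℝ}
    (hε : 0 < ε) : limsup (fun n : ℕ => (e n : EReal)) atTop < (ε : EReal) := by
  have hlim : Tendsto (fun n => (e n : EReal)) atTop (𝓝 ((0 : ℝ) : EReal)) :=
    (continuous_coe_real_ereal.tendsto 0).comp he
  rw [hlim.limsup_eq]
  exact EReal.coe_lt_coe_iff.mpr hε

theorem isAchievableRate_of_tendsto_zero {R' : ℝ} (hR : R < R')
    (c : ∀ n : ℕ, Code n ⌈(2 : ℝ) ^ ((n : ℝ) * R')⌉₊) {e : ℕ → ℝ} (hc : ∀ n, err n _ (c n) ≤ e n)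
    (he : Tendsto e atTop (𝓝 0)) : IsAchievableRate Code err R := by
  refine fun ε hε => ⟨_, e, c, fun n => ceil_two_rpow_pos _, hc, ?_,
    limsup_coe_lt_of_tendsto_zero he hε⟩
  refine (EReal.coe_lt_coe_iff.mpr hR).trans_le (le_liminf_of_le (by isBoundedDefault) ?_)
  filter_upwards [eventually_gt_atTop 0] with n hn
  exact EReal.coe_le_coe_iff.mpr
    ((two_rpow_le_iff_le_rate hn (ceil_two_rpow_pos _)).mp (Nat.le_ceil _))

theorem isAchievableRate_of_neg (c : ∀ n, Code n 1) (hc : ∀ n, err n 1 (c n) ≤ 0) (hR : R < 0) :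
    IsAchievableRate Code err R :=
  fun _ hε => ⟨fun _ => 1, fun _ => 0, c, fun _ => one_pos, hc, by simpa using hR,
    limsup_coe_lt_of_tendsto_zero tendsto_const_nhds hε⟩

theorem IsAchievableRate.exists_tendsto_zero (hR : IsAchievableRate Code err R) :
    ∃ (M : ℕ → ℕ) (e : ℕ → ℝ) (c : ∀ n, Code n (M n)), (∀ n, 0 < M n) ∧ Tendsto e atTop (𝓝 0) ∧
      ∀ᶠ n : ℕ in atTop, R < 1 / (n : ℝ) * Real.logb 2 (M n) ∧ err n (M n) (c n) ≤ e n := by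
  let IsGood (n M : ℕ) (c : Code n M) (ε : ℝ) : Prop :=
    R < 1 / (n : ℝ) * Real.logb 2 M ∧ err n M c ≤ ε
  obtain ⟨e, he, hgood⟩ := exists_tendsto_zero_of_forall_eventually
    (P := fun n ε => ∃ M, 0 < M ∧ ∃ c : Code n M, IsGood n M c ε) fun ε hε => by
      obtain ⟨M, e, c, hM, herr, hrate, hlim⟩ := hR ε hε
      filter_upwards [eventually_lt_of_lt_liminf hrate, eventually_lt_of_limsup_lt hlim]
        with n hn hen
      exact ⟨M n, hM n, c n, EReal.coe_lt_coe_iff.mp hn,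
        (herr n).trans (EReal.coe_lt_coe_iff.mp hen).le⟩
  obtain ⟨M₀, -, c₀, hM₀, -⟩ := hR 1 one_pos
  have hcode (n : ℕ) : ∃ M, 0 < M ∧ ∃ c : Code n M,
      (∃ M, 0 < M ∧ ∃ c : Code n M, IsGood n M c (e n)) → IsGood n M c (e n) := by
    by_cases h : ∃ M, 0 < M ∧ ∃ c : Code n M, IsGood n M c (e n)
    · obtain ⟨M, hM, c, hc⟩ := h
      exact ⟨M, hM, c, fun _ => hc⟩
    · exact ⟨M₀ n, hM₀ n, c₀ n, fun h' => absurd h' h⟩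
  choose M hM c hc using hcode
  exact ⟨M, e, c, hM, he, hgood.mono hc⟩

theorem sSup_coe_image_eq_iSup {A : Set ℝ} {ι : Type*} {f : ι → EReal}
    (hle : ∀ R ∈ A, ∃ i, (R : EReal) ≤ f i) (hlt : ∀ (i : ι) (R : ℝ), (R : EReal) < f i → R ∈ A) :
    sSup ((fun R : ℝ => (R : EReal)) '' A) = ⨆ i, f i := by
  refine le_antisymm (sSup_le ?_) (iSup_le fun i => le_of_forall_lt fun b hb => ?_)
  · rintro _ ⟨R, hR, rfl⟩
    obtain ⟨i, hi⟩ := hle R hR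
    exact le_iSup_of_le i hi
  · obtain ⟨R, hbR, hR⟩ := EReal.lt_iff_exists_real_btwn.mp hb
    exact hbR.trans_le (le_sSup ⟨R, hlt i R hR, rfl⟩)

end AchievableRate

/-! ### Information-spectrum rates -/

section SpectralRate

variable {U S d : ℕ → Type*} [∀ n, Fintype (U n)]

theorem exists_tendsto_miAccept_of_lt_spectralInfMI [∀ n, DecidableEq (U n)] [∀ n, Fintype (d n)]
    [∀ n, DecidableEq (d n)] {τ : ∀ n, Matrix (U n × d n) (U n × d n) ℂ} {R : ℝ}
    (hR : (R : EReal) < spectralInfMI τ) :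
    ∃ a : ℝ, R < a ∧ ∀ γ : ℝ, 0 < γ →
      Tendsto (fun n : ℕ => miAccept (τ n) (2 ^ ((n : ℝ) * (a - γ)))) atTop (𝓝 1) := by
  obtain ⟨_, ⟨a, ha, rfl⟩, hRa⟩ := lt_sSup_iff.mp hR
  exact ⟨a, EReal.coe_lt_coe_iff.mp hRa, ha⟩

theorem le_spectralInfMI_of_codes [∀ n, DecidableEq (U n)] [∀ n, Fintype (d n)]
    [∀ n, DecidableEq (d n)] {ω : ∀ n, U n → Matrix (d n) (d n) ℂ} (hω : ∀ n, IsEnsemble (ω n))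
    {M : ℕ → ℕ} (hM : ∀ n, 0 < M n) {e err : ℕ → ℝ} (he : Tendsto e atTop (𝓝 0)) {R : ℝ}
    (hR : ∀ᶠ n : ℕ in atTop, R < 1 / (n : ℝ) * Real.logb 2 (M n) ∧ err n ≤ e n)
    (haccept : ∀ n c, 0 ≤ c → 1 - err n - c / M n ≤ miAccept (cqBlock (ω n)) c) :
    (R : EReal) ≤ spectralInfMI (fun n => cqBlock (ω n)) := by
  refine le_sSup ⟨R, fun γ hγ => ?_, rfl⟩
  have hlow : Tendsto (fun n : ℕ => 1 - e n - (2 : ℝ) ^ ((n : ℝ) * (-γ))) atTop (𝓝 1) := by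
    simpa using (he.const_sub 1).sub (tendsto_two_rpow_neg hγ)
  refine tendsto_of_tendsto_of_tendsto_of_le_of_le' hlow tendsto_const_nhds ?_
    (Eventually.of_forall fun n => (hω n).miAccept_le_one _)
  filter_upwards [hR, eventually_gt_atTop 0] with n ⟨hRn, hen⟩ hn
  have hsize : (2 : ℝ) ^ ((n : ℝ) * (R - γ)) / M n ≤ (2 : ℝ) ^ ((n : ℝ) * (-γ)) := by
    rw [div_le_iff₀ (Nat.cast_pos.mpr (hM n)), show (n : ℝ) * (R - γ) = n * -γ + n * R by ring,
      Real.rpow_add two_pos]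
    exact mul_le_mul_of_nonneg_left ((two_rpow_le_iff_le_rate hn (hM n)).mpr hRn.le)
      (by positivity)
  have := haccept n ((2 : ℝ) ^ ((n : ℝ) * (R - γ))) (by positivity)
  exact le_trans (by linarith) this

theorem sum_ite_rate_lt_eq_ratioTail {U S : Type*} [Fintype U] [Fintype S] {q : U → S → ℝ}
    (hq : ∀ u s, 0 ≤ q u s) {n : ℕ} (hn : 0 < n) (b : ℝ) :
    ∑ u, ∑ s, (if b < 1 / (n : ℝ) * Real.logb 2 (q u s / ((∑ s', q u s') * (∑ u', q u' s)))
        then q u s else 0)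
      = ratioTail q (2 ^ ((n : ℝ) * b)) := by
  refine Finset.sum_congr rfl fun u _ => Finset.sum_congr rfl fun s _ => ?_
  change (if b < 1 / (n : ℝ) * Real.logb 2 (likelihoodRatio q u s) then q u s else 0) = _
  rcases (hq u s).eq_or_lt with h | h
  · simp [← h]
  · have hne : likelihoodRatio q u s ≠ 0 := fun h0 => by
      have := marginalSnd_mul_marginalFst_mul_likelihoodRatio hq u s
      rw [h0, mul_zero, mul_zero] at this
      exact h.ne this
    have hratio := (likelihoodRatio_nonneg hq u s).lt_of_ne' hne
    refine if_congr ?_ rfl rfl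
    rw [← Real.lt_logb_iff_rpow_lt one_lt_two hratio, one_div, ← div_eq_inv_mul,
      lt_div_iff₀' (Nat.cast_pos.mpr hn)]

variable [∀ n, Fintype (S n)] {q : ∀ n, U n → S n → ℝ}

theorem spectralSupMI_eq_sInf_ratioTail (hq : ∀ n u s, 0 ≤ q n u s) :
    spectralSupMI q = sInf ((fun a : ℝ => (a : EReal)) '' {a : ℝ | ∀ γ : ℝ, 0 < γ →
      Tendsto (fun n : ℕ => ratioTail (q n) (2 ^ ((n : ℝ) * (a + γ)))) atTop (𝓝 0)}) := by
  refine congrArg sInf (congrArg _ (Set.ext fun a => forall₂_congr fun γ _ => tendsto_congr' ?_))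
  filter_upwards [eventually_gt_atTop 0] with n hn
  exact sum_ite_rate_lt_eq_ratioTail (hq n) hn (a + γ)

theorem exists_tendsto_ratioTail_of_spectralSupMI_lt (hq : ∀ n u s, 0 ≤ q n u s) {R : ℝ}
    (hR : spectralSupMI q < (R : EReal)) :
    ∃ b : ℝ, b < R ∧ ∀ γ : ℝ, 0 < γ →
      Tendsto (fun n : ℕ => ratioTail (q n) (2 ^ ((n : ℝ) * (b + γ)))) atTop (𝓝 0) := by
  rw [spectralSupMI_eq_sInf_ratioTail hq] at hR
  obtain ⟨_, ⟨b, hb, rfl⟩, hbR⟩ := sInf_lt_iff.mp hR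
  exact ⟨b, EReal.coe_lt_coe_iff.mp hbR, hb⟩

theorem ratioTail_eq_zero {U S : Type*} [Fintype U] [Fintype S] {q : U → S → ℝ} {t : ℝ}
    (h : ∀ u s, likelihoodRatio q u s ≤ t) : ratioTail q t = 0 :=
  Finset.sum_eq_zero fun u _ => Finset.sum_eq_zero fun s _ => if_neg (h u s).not_gt

theorem spectralSupMI_nonpos_of_likelihoodRatio_le_one (hq : ∀ n u s, 0 ≤ q n u s)
    (h : ∀ n u s, likelihoodRatio (q n) u s ≤ 1) : spectralSupMI q ≤ 0 := by
  rw [spectralSupMI_eq_sInf_ratioTail hq]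
  refine sInf_le ⟨0, fun γ hγ => tendsto_const_nhds.congr fun n => ?_, rfl⟩
  refine (ratioTail_eq_zero fun u s => (h n u s).trans ?_).symm
  exact Real.one_le_rpow one_le_two (by positivity)

theorem one_le_ratioTail_add {U S : Type*} [Fintype U] [Fintype S] {q : U → S → ℝ}
    (hq : ∀ u s, 0 ≤ q u s) (hq1 : ∑ u, marginalFst q u = 1) {t : ℝ} (ht : 0 ≤ t) :
    1 ≤ ratioTail q t + t := by
  have hsnd : ∑ s, marginalSnd q s = 1 := hq1 ▸ Finset.sum_comm
  have hmean (s : S) : ∑ u, marginalFst q u * truncRatio q t u s ≤ t := calc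
    _ ≤ ∑ u, marginalFst q u * t := Finset.sum_le_sum fun u _ =>
        mul_le_mul_of_nonneg_left (truncRatio_mem_Icc hq ht u s).2 (marginalFst_nonneg hq u)
    _ = t := by rw [← Finset.sum_mul, hq1, one_mul]
  have : 1 - t ≤ ratioTail q t := calc
    1 - t = ∑ s, marginalSnd q s * (1 - t) := by rw [← Finset.sum_mul, hsnd, one_mul]
    _ ≤ ∑ s, marginalSnd q s * (1 - ∑ u, marginalFst q u * truncRatio q t u s) :=
        Finset.sum_le_sum fun s _ => mul_le_mul_of_nonneg_left (sub_le_sub_left (hmean s) 1)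
          (marginalSnd_nonneg hq s)
    _ = ratioTail q t := sum_marginalSnd_mul_one_sub_truncRatio hq
  linarith

theorem nonneg_of_tendsto_ratioTail (hq : ∀ n u s, 0 ≤ q n u s)
    (hq1 : ∀ n, ∑ u, marginalFst (q n) u = 1) {b : ℝ} (hb : ∀ γ : ℝ, 0 < γ →
      Tendsto (fun n : ℕ => ratioTail (q n) (2 ^ ((n : ℝ) * (b + γ)))) atTop (𝓝 0)) : 0 ≤ b := by
  by_contra! hb0
  have hγ : 0 < -b / 2 := by linarith
  have hlim := (hb _ hγ).add (tendsto_two_rpow_neg hγ)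
  rw [add_zero, show b + -b / 2 = -(-b / 2) by ring] at hlim
  exact absurd (ge_of_tendsto' hlim fun n => one_le_ratioTail_add (hq n) (hq1 n) (by positivity))
    one_pos.not_ge

end SpectralRate

/-! ### Capacity of classical-quantum channels -/

section Capacity

variable {X S B : Type*} [Fintype X] [Fintype B] [DecidableEq B]

section ClassicalQuantum

variable [DecidableEq X]

theorem CQCode.exists_error_le_of_rate {n : ℕ} {p : (Fin n → X) → ℝ}
    (hp : p ∈ stdSimplex ℝ (Fin n → X)) {ρ : (Fin n → X) → Matrix (Fin n → B) (Fin n → B) ℂ}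
    (hρ : ∀ x, IsDensity (ρ x)) {R γ : ℝ} (hR : 0 ≤ R) (hγ : 0 < γ) :
    ∃ C : CQCode X B n ⌈(2 : ℝ) ^ ((n : ℝ) * (R + γ))⌉₊, C.error ρ
      ≤ 2 * (1 - miAccept (cqState p ρ) (2 ^ ((n : ℝ) * (R + 3 * γ - γ))))
        + 12 * 2 ^ ((n : ℝ) * (-γ)) := by
  obtain ⟨C, hC⟩ := CQCode.exists_error_le (B := B) hp hρ
    (c := (2 : ℝ) ^ ((n : ℝ) * (R + 3 * γ - γ))) (δ := (2 : ℝ) ^ ((n : ℝ) * (-γ)))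
    (by positivity) (by positivity) (ceil_two_rpow_pos ((n : ℝ) * (R + γ)))
  have hsize := mul_inv_two_rpow_le (y := (n : ℝ) * (R + 3 * γ - γ)) (z := (n : ℝ) * (-γ))
    (ceil_two_rpow_le (by positivity : 0 ≤ (n : ℝ) * (R + γ))) (by ring)
  exact ⟨C, by linarith⟩

variable {ρ : ∀ n, (Fin n → X) → Matrix (Fin n → B) (Fin n → B) ℂ}

theorem cqAchievable_of_lt_spectralInfMI (hρ : ∀ n x, IsDensity (ρ n x))
    (p : ∀ n : ℕ, stdSimplex ℝ (Fin n → X)) {R : ℝ}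
    (hR : (R : EReal) < spectralInfMI (fun n => cqState (p n : (Fin n → X) → ℝ) (ρ n))) :
    CQAchievable ρ R := by
  rcases lt_or_ge R 0 with hneg | hnonneg
  · exact isAchievableRate_of_neg (Code := CQCode X B) (err := fun n _ C => C.error (ρ n))
      (fun n => ⟨fun _ => p n, fun _ => (p n).2, fun _ => 1, fun _ => .one, by simp⟩)
      (fun n => by simp [CQCode.error]) hneg
  obtain ⟨a, hRa, ha⟩ := exists_tendsto_miAccept_of_lt_spectralInfMI hR
  obtain ⟨γ, hγ, rfl⟩ : ∃ γ : ℝ, 0 < γ ∧ a = R + 3 * γ := ⟨(a - R) / 3, by linarith, by ring⟩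
  choose C hC using fun n =>
    CQCode.exists_error_le_of_rate (p := p n) (p n).2 (hρ n) hnonneg hγ
  refine isAchievableRate_of_tendsto_zero (Code := CQCode X B) (err := fun n _ C => C.error (ρ n))
    (lt_add_of_pos_right R hγ) C hC ?_
  simpa using (((ha γ hγ).const_sub 1).const_mul 2).add ((tendsto_two_rpow_neg hγ).const_mul 12)

theorem CQAchievable.exists_le_spectralInfMI (hρ : ∀ n x, IsDensity (ρ n x)) {R : ℝ}
    (hR : CQAchievable ρ R) : ∃ p : ∀ n : ℕ, stdSimplex ℝ (Fin n → X),
      (R : EReal) ≤ spectralInfMI (fun n => cqState (p n : (Fin n → X) → ℝ) (ρ n)) := by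
  obtain ⟨M, e, C, hM, he, hrate⟩ :=
    IsAchievableRate.exists_tendsto_zero (Code := CQCode X B)
      (err := fun n _ C => C.error (ρ n)) hR
  choose p hp using fun n => (C n).exists_input_le_miAccept (hM n) (hρ n)
  refine ⟨p, ?_⟩
  simp only [cqState_eq_cqBlock] at hp ⊢
  exact le_spectralInfMI_of_codes (fun n => IsDensity.isEnsemble_smul (hρ n) (p n).2) hM he hrate hp

theorem cqCapacity_eq (hρ : ∀ n x, IsDensity (ρ n x)) :
    cqCapacity ρ = ⨆ p : ∀ n : ℕ, stdSimplex ℝ (Fin n → X),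
      spectralInfMI (fun n => cqState (p n : (Fin n → X) → ℝ) (ρ n)) :=
  sSup_coe_image_eq_iSup (fun _ hR => CQAchievable.exists_le_spectralInfMI hρ hR)
    fun p _ => cqAchievable_of_lt_spectralInfMI hρ p

end ClassicalQuantum

/-! ### Capacity of classical-quantum Gel'fand–Pinsker channels -/

section GelfandPinsker

variable [Fintype S]

theorem GPCode.exists_error_le_of_rates {n : ℕ} (a : AuxInput X S n) {pS : (Fin n → S) → ℝ}
    (hS : pS ∈ stdSimplex ℝ (Fin n → S))
    {ρ : (Fin n → X) → (Fin n → S) → Matrix (Fin n → B) (Fin n → B) ℂ}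
    (hρ : ∀ x s, IsDensity (ρ x s)) {R b γ : ℝ} (hR : 0 ≤ R) (hb : 0 ≤ b) (hγ : 0 < γ) :
    ∃ C : GPCode X S B n ⌈(2 : ℝ) ^ ((n : ℝ) * (R + γ))⌉₊, C.error ρ pS
      ≤ ratioTail (a.jointUS pS) (2 ^ ((n : ℝ) * (b + γ)))
        + 2 * (1 - miAccept (cqBlock (jointEnsemble (a.jointUS pS) (a.channel ρ)))
            (2 ^ ((n : ℝ) * (R + b + 6 * γ - γ))))
        + 22 * 2 ^ ((n : ℝ) * (-γ)) := by
  obtain ⟨C, hC⟩ := GPCode.exists_error_le a hS hρ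
    (c := (2 : ℝ) ^ ((n : ℝ) * (R + b + 6 * γ - γ))) (t := (2 : ℝ) ^ ((n : ℝ) * (b + γ)))
    (η := (2 : ℝ) ^ ((n : ℝ) * (-γ))) (δ := (2 : ℝ) ^ ((n : ℝ) * (-γ))) (by positivity)
    (by positivity) (by positivity) (by positivity) (ceil_two_rpow_pos ((n : ℝ) * (R + γ)))
    (ceil_two_rpow_pos ((n : ℝ) * (b + 3 * γ)))
  have hL0 : (0 : ℝ) < ⌈(2 : ℝ) ^ ((n : ℝ) * (b + 3 * γ))⌉₊ :=
    Nat.cast_pos.mpr (ceil_two_rpow_pos _)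
  have hcover : (2 : ℝ) ^ ((n : ℝ) * (b + γ)) / (⌈(2 : ℝ) ^ ((n : ℝ) * (b + 3 * γ))⌉₊
      * (2 : ℝ) ^ ((n : ℝ) * (-γ))) ≤ (2 : ℝ) ^ ((n : ℝ) * (-γ)) := by
    rw [div_le_iff₀ (by positivity)]
    calc (2 : ℝ) ^ ((n : ℝ) * (b + γ))
        = 2 ^ ((n : ℝ) * (-γ)) * (2 ^ ((n : ℝ) * (b + 3 * γ)) * 2 ^ ((n : ℝ) * (-γ))) := by
          rw [← Real.rpow_add two_pos, ← Real.rpow_add two_pos]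
          ring_nf
      _ ≤ _ := by
          gcongr
          exact Nat.le_ceil _
  have hcount : (⌈(2 : ℝ) ^ ((n : ℝ) * (R + γ))⌉₊ * ⌈(2 : ℝ) ^ ((n : ℝ) * (b + 3 * γ))⌉₊ : ℝ)
      ≤ 4 * 2 ^ ((n : ℝ) * (R + γ + (b + 3 * γ))) := by
    rw [mul_add (n : ℝ) (R + γ), Real.rpow_add two_pos]
    refine (mul_le_mul (ceil_two_rpow_le (by positivity)) (ceil_two_rpow_le (by positivity))
      hL0.le (by positivity)).trans_eq (by ring)
  have hsize := mul_inv_two_rpow_le (y := (n : ℝ) * (R + b + 6 * γ - γ)) (z := (n : ℝ) * (-γ))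
    hcount (by ring)
  exact ⟨C, by linarith⟩

theorem GPCode.likelihoodRatio_jointUS_auxInput_le_one {n M : ℕ} (C : GPCode X S B n M)
    (hM : 0 < M) {pS : (Fin n → S) → ℝ} (hS : ∑ s, pS s = 1) (u : Fin M) (s : Fin n → S) :
    likelihoodRatio ((C.auxInput hM).jointUS pS) u s ≤ 1 := by
  rw [likelihoodRatio, C.marginalFst_jointUS_auxInput hM hS, AuxInput.marginalSnd_jointUS,
    C.jointUS_auxInput hM]
  exact div_self_le_one _

variable [DecidableEq X] [DecidableEq S]
  {ρ : ∀ n, (Fin n → X) → (Fin n → S) → Matrix (Fin n → B) (Fin n → B) ℂ}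
  {pS : ∀ n, (Fin n → S) → ℝ}

theorem spectralInfMI_reduceUB_theta (a : ∀ n : ℕ, AuxInput X S n) :
    spectralInfMI (fun n => reduceUB ((a n).theta (ρ n) (pS n))) =
      spectralInfMI (fun n => cqBlock (jointEnsemble ((a n).jointUS (pS n))
        ((a n).channel (ρ n)))) := by
  simp only [AuxInput.reduceUB_theta]

theorem gpAchievable_of_lt_spectralInfMI_sub_spectralSupMI (hρ : ∀ n x s, IsDensity (ρ n x s))
    (hS : ∀ n, pS n ∈ stdSimplex ℝ (Fin n → S)) (a : ∀ n : ℕ, AuxInput X S n) {R : ℝ}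
    (hR : (R : EReal) < spectralInfMI (fun n => reduceUB ((a n).theta (ρ n) (pS n))) -
      spectralSupMI (fun n => (a n).jointUS (pS n))) :
    GPAchievable ρ pS R := by
  rcases lt_or_ge R 0 with hneg | hnonneg
  · exact isAchievableRate_of_neg (Code := GPCode X S B)
      (err := fun n _ C => C.error (ρ n) (pS n))
      (fun n => ⟨fun _ s => ∑ u, (a n).pU s u • (a n).pX u s, fun _ s =>
        (convex_stdSimplex ℝ _).sum_mem (fun u _ => ((a n).pU_mem s).1 u) ((a n).pU_mem s).2
          fun u _ => (a n).pX_mem u s, fun _ => 1, fun _ => .one, by simp⟩)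
      (fun n => by simp [GPCode.error]) hneg
  rw [EReal.lt_sub_iff_add_lt (.inr (EReal.coe_ne_top R)) (.inr (EReal.coe_ne_bot R))] at hR
  obtain ⟨r, hSr, hrI⟩ := EReal.lt_iff_exists_real_btwn.mp hR
  rw [spectralInfMI_reduceUB_theta] at hrI
  obtain ⟨i, hri, hi⟩ := exists_tendsto_miAccept_of_lt_spectralInfMI hrI
  rw [add_comm, ← EReal.lt_sub_iff_add_lt (.inl (EReal.coe_ne_bot R)) (.inl (EReal.coe_ne_top R)),
    ← EReal.coe_sub] at hSr
  have hq n := (a n).jointUS_nonneg (hS n).1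
  obtain ⟨b, hbr, hb⟩ := exists_tendsto_ratioTail_of_spectralSupMI_lt hq hSr
  have hb0 := nonneg_of_tendsto_ratioTail hq (fun n => (a n).sum_marginalFst_jointUS (hS n).2) hb
  obtain ⟨γ, hγ, rfl⟩ : ∃ γ : ℝ, 0 < γ ∧ i = R + b + 6 * γ :=
    ⟨(i - R - b) / 6, by linarith, by ring⟩
  choose C hC using fun n =>
    GPCode.exists_error_le_of_rates (a n) (hS n) (hρ n) hnonneg hb0 hγ
  refine isAchievableRate_of_tendsto_zero (Code := GPCode X S B)
    (err := fun n _ C => C.error (ρ n) (pS n)) (lt_add_of_pos_right R hγ) C hC ?_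
  simpa using ((hb γ hγ).add (((hi γ hγ).const_sub 1).const_mul 2)).add
    ((tendsto_two_rpow_neg hγ).const_mul 22)

theorem GPAchievable.exists_le_spectralInfMI_sub_spectralSupMI (hρ : ∀ n x s, IsDensity (ρ n x s))
    (hS : ∀ n, pS n ∈ stdSimplex ℝ (Fin n → S)) {R : ℝ} (hR : GPAchievable ρ pS R) :
    ∃ a : ∀ n : ℕ, AuxInput X S n,
      (R : EReal) ≤ spectralInfMI (fun n => reduceUB ((a n).theta (ρ n) (pS n))) -
        spectralSupMI (fun n => (a n).jointUS (pS n)) := by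
  obtain ⟨M, e, C, hM, he, hrate⟩ :=
    IsAchievableRate.exists_tendsto_zero (Code := GPCode X S B)
      (err := fun n _ C => C.error (ρ n) (pS n)) hR
  refine ⟨fun n => (C n).auxInput (hM n), ?_⟩
  have hUB := (le_spectralInfMI_of_codes
    (fun n => ((C n).auxInput (hM n)).isEnsemble_jointEnsemble (hρ n) (hS n)) hM he hrate
    fun n _ hc => (C n).one_sub_error_sub_le_miAccept (hM n) (hρ n) (hS n) hc).trans_eq
      (spectralInfMI_reduceUB_theta fun n => (C n).auxInput (hM n)).symm
  have hUS : spectralSupMI (fun n => ((C n).auxInput (hM n)).jointUS (pS n)) ≤ 0 :=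
    spectralSupMI_nonpos_of_likelihoodRatio_le_one
      (fun n => AuxInput.jointUS_nonneg _ (hS n).1)
      fun n => (C n).likelihoodRatio_jointUS_auxInput_le_one (hM n) (hS n).2
  simpa only [sub_zero] using EReal.sub_le_sub hUB hUS

theorem gpCapacity_eq (hρ : ∀ n x s, IsDensity (ρ n x s))
    (hS : ∀ n, pS n ∈ stdSimplex ℝ (Fin n → S)) :
    gpCapacity ρ pS = ⨆ a : ∀ n : ℕ, AuxInput X S n,
      (spectralInfMI (fun n => reduceUB ((a n).theta (ρ n) (pS n))) -
        spectralSupMI (fun n => (a n).jointUS (pS n))) :=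
  sSup_coe_image_eq_iSup
    (fun _ hR => GPAchievable.exists_le_spectralInfMI_sub_spectralSupMI hρ hS hR)
    fun a _ => gpAchievable_of_lt_spectralInfMI_sub_spectralSupMI hρ hS a

end GelfandPinsker

end Capacity

end CQ

theorem corollary1 {X S B : Type*} [Fintype X] [DecidableEq X] [Nonempty X]
    [Fintype S] [DecidableEq S] [Fintype B] [DecidableEq B] :
    (∀ ρ : ∀ n : ℕ, (Fin n → X) → Matrix (Fin n → B) (Fin n → B) ℂ,
      (∀ n x, CQ.IsDensity (ρ n x)) →
      CQ.cqCapacity ρ =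
        ⨆ p : ∀ n : ℕ, stdSimplex ℝ (Fin n → X),
          CQ.spectralInfMI (fun n => CQ.cqState (p n : (Fin n → X) → ℝ) (ρ n))) ∧
    (∀ (ρ : ∀ n : ℕ, (Fin n → X) → (Fin n → S) → Matrix (Fin n → B) (Fin n → B) ℂ)
      (pS : ∀ n : ℕ, (Fin n → S) → ℝ),
      (∀ n x s, CQ.IsDensity (ρ n x s)) → (∀ n, pS n ∈ stdSimplex ℝ (Fin n → S)) →
      CQ.gpCapacity ρ pS =
        ⨆ a : ∀ n : ℕ, CQ.AuxInput X S n,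
          (CQ.spectralInfMI (fun n => CQ.reduceUB ((a n).theta (ρ n) (pS n))) -
            CQ.spectralSupMI (fun n => (a n).jointUS (pS n)))) :=
  ⟨fun _ hρ => CQ.cqCapacity_eq hρ, fun _ _ hρ hS => CQ.gpCapacity_eq hρ hS⟩
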